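/- Let $D$ be a link diagram (in the plane, with finitely many crossings), let $A$ be its finite set of crossings, and let $\mathbb B=\mathbb B_A$ be the poset of subsets of $A$ ordered by reverse inclusion ($x\le y$ iff $x\supseteq y$), with maximal element $\mathbf 1=\varnothing$. Write $x\prec y$ if $x=y\cup\{a\}$ with $a\notin y$. Regard posets as categories with one morphism $x\to y$ whenever $x\le y$. For $x\in\mathbb B$ let $D(x)$ be the collection of planar circles obtained from $D$ by $1$-resolving the crossings in $x$ and $0$-resolving the others. Here, for a crossing whose over-strand runs from north-west to south-east, the $0$-resolution joins NW to NE and SW to SE, and the $1$-resolution joins NW to SW and NE to SE. Let $V=\mathbb Z[1,u]$ be the free abelian group on $1,u$, with the commutative multiplication $m$ for which $1$ is the unit and $u\cdot u=0$, and with the comultiplication $\Delta(1)=1\otimes u+u\otimes 1$, $\Delta(u)=u\otimes u$. The Khovanov presheaf $F_{KH}\colon\mathbb B^{\mathrm{op}}\to\mathbf{Ab}$ sends $x$ to $V^{\otimes k}$, with one tensor factor for each of the $k$ circles of $D(x)$. For $x\prec y$ the map $F_{KH}(x\prec y)\colon F_{KH}(y)\to F_{KH}(x)$ applies $m$ to the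 factors of the two circles of $D(y)$ that fuse in $D(x)$, or $\Delta$ to the factor of the circle of $D(y)$ that bifurcates in $D(x)$, and is the identity on all other factors; other morphisms are sent to the composites of these maps. Choose signs $[x,y]=\pm1$ for all $x\prec y$ such that every square face of the cube $\mathbb B$ has an odd number of minus signs on its edges. The unnormalised Khovanov homology $\overline{KH}^{*}(D)$ is the cohomology of the complex $K^n=\bigoplus_{|x|=n}F_{KH}(x)$ with differential $d\colon K^{n-1}\to K^{n}$, $d=\sum_{x\prec y,\ |x|=n}[x,y]\,F_{KH}(x\prec y)$. Let $\mathbb B'$ be the poset obtained from $\mathbb B$ by adjoining one further maximal element $\mathbf 1'$ with $x\le\mathbf 1'$ for all $x\in\mathbb B$, $x\ne\mathbf 1$ (so that $\mathbf 1$ and $\mathbf 1'$ are incomparable). Extend $F_{KH}$ to $F_{KH}\colon\mathbb B'^{\mathrm{op}}\to\mathbf{Ab}$ by $F_{KH}(\mathbf 1')=0$. For a small category $\mathbf C$ and a presheaf $F\colon\mathbf C^{\mathrm{op}}\to\mathbf{Ab}$, let $H^*(B\mathbf C;F)$, the cohomology of the classifying space of $\mathbf C$ with local coefficients in $F$, be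 the cohomology of the cochain complex $C^n(B\mathbf C,F)=\prod_{x_0\to\cdots\to x_n}F(x_0)$ (the product over all sequences of $n$ composable morphisms of $\mathbf C$) with coboundary $$d\lambda(x_0\xrightarrow{f_1}\cdots\xrightarrow{f_{n+1}}x_{n+1})=F(f_1)\bigl(\lambda(x_1\to\cdots\to x_{n+1})\bigr)+\sum_{i=1}^{n+1}(-1)^i\lambda(x_0\to\cdots\widehat{x_i}\cdots\to x_{n+1}),$$ where $\widehat{x_i}$ means that $x_i$ is omitted (composing the two adjacent morphisms if $i\le n$). Then for every link diagram $D$, for every such choice of signs, and for every $i\ge0$, there is an isomorphism of abelian groups $$\overline{KH}^{i}(D)\;\cong\;H^{i}(B\mathbb B';F_{KH}).$$ -/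

import Mathlib

/-- A finite four-valent graph drawn on a closed oriented surface as a union of crossings, together
with finitely many circles without crossings, recorded combinatorially.

Every crossing `c` has four ends `(c, 0), (c, 1), (c, 2), (c, 3)`, listed counterclockwise around the
crossing; the under-strand runs between the ends `0` and `2`, the over-strand between the ends `1` and
`3`.  The fixed-point free involution `glue` records which ends are joined by the edges of the graph. -/
structure CrossingGraph where
  Crossing : Type
  [fintypeCrossing : Fintype Crossing]
  [decEqCrossing : DecidableEq Crossing]
  glue : Equiv.Perm (Crossing × Fin 4)
  glue_glue : ∀ h, glue (glue h) = h
  glue_ne : ∀ h, glue h ≠ h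
  freeCircles : ℕ

attribute [instance] CrossingGraph.fintypeCrossing CrossingGraph.decEqCrossing

namespace CrossingGraph

variable (G : CrossingGraph)

/-- The ends of the crossings (half-edges). -/
abbrev End : Type := G.Crossing × Fin 4

/-- Rotation by one step counterclockwise around each crossing. -/
def rot : Equiv.Perm G.End := Equiv.prodCongr (Equiv.refl _) (Equiv.addRight 1)

/-- The edges: the orbits of `glue`. -/
abbrev Edge : Type := Quotient (Equiv.Perm.SameCycle.setoid G.glue)

/-- The faces: the orbits of "cross the edge, then turn to the next end". -/
abbrev Face : Type := Quotient (Equiv.Perm.SameCycle.setoid (G.rot * G.glue))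

/-- The connected components of the four-valent graph (free circles not counted). -/
abbrev Component : Type :=
  Quotient (Relation.EqvGen.setoid
    fun c c' : G.Crossing => ∃ i j : Fin 4, G.glue (c, i) = (c', j))

end CrossingGraph

/-- An (unoriented) link diagram: a planar `CrossingGraph`.  Planarity is Euler's formula
`V - E + F = 2 C`, which says that the surface obtained by gluing a disc to every face is a disjoint
union of spheres. -/
structure LinkDiagram extends CrossingGraph where
  planar : (Nat.card toCrossingGraph.Crossing : ℤ) - Nat.card toCrossingGraph.Edge
    + Nat.card toCrossingGraph.Face = 2 * Nat.card toCrossingGraph.Component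

theorem sameCycle_mul_swap_iff {α : Type*} [Finite α] [DecidableEq α] (σ : Equiv.Perm α) {i j : α}
    (hij : i ≠ j) : σ.SameCycle i j ↔ ¬ (σ * Equiv.swap i j).SameCycle i j := by
  set τ := σ * Equiv.swap i j with hτ
  have hi : τ i = σ j := by simp [hτ]
  have hk : ∀ k, k ≠ i → k ≠ j → τ k = σ k := by
    intro k h1 h2; simp [hτ, Equiv.swap_apply_of_ne_of_ne h1 h2]
  constructor
  · intro h h'
    have hex : ∃ k : ℕ, 0 < k ∧ (σ ^ k) j = i := by
      obtain ⟨k, hk0, -, hk⟩ := h.symm.exists_pow_eq''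
      exact ⟨k, hk0, hk⟩
    classical
    set k := Nat.find hex with hkdef
    obtain ⟨hk0, hki⟩ := Nat.find_spec hex
    have hmin : ∀ l, 0 < l → l < k → (σ ^ l) j ≠ i := fun l h0 hl he =>
      Nat.find_min hex hl ⟨h0, he⟩
    have hj : ∀ l, 0 < l → l ≤ k → (σ ^ l) j ≠ j := by
      intro l h0 hl he
      rcases hl.lt_or_eq with hl | rfl
      · apply hmin (k - l) (by omega) (by omega)
        have : (σ ^ (k - l + l)) j = i := by rw [Nat.sub_add_cancel hl.le]; exact hki
        rwa [pow_add, Equiv.Perm.mul_apply, he] at this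
      · exact hij (hki.symm.trans he)
    have key : ∀ n : ℕ, ∃ l, 0 < l ∧ l ≤ k ∧ (τ ^ n) i = (σ ^ l) j := by
      intro n
      induction n with
      | zero => exact ⟨k, hk0, le_rfl, by simpa using hki.symm⟩
      | succ n ih =>
        obtain ⟨l, h0, hl, he⟩ := ih
        rw [pow_succ', Equiv.Perm.mul_apply, he]
        rcases hl.lt_or_eq with hl | rfl
        · refine ⟨l + 1, by omega, by omega, ?_⟩
          rw [hk _ (hmin l h0 hl) (hj l h0 hl.le), pow_succ', Equiv.Perm.mul_apply]
        · refine ⟨1, by omega, by omega, ?_⟩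
          rw [hki, hi, pow_one]
    obtain ⟨n, -, -, hn⟩ := h'.exists_pow_eq''
    obtain ⟨l, h0, hl, he⟩ := key n
    exact hj l h0 hl (he.symm.trans hn)
  · intro h
    by_contra hσ
    apply h
    have key : ∀ n : ℕ, τ.SameCycle i ((σ ^ (n + 1)) j) := by
      intro n
      induction n with
      | zero => rw [zero_add, pow_one, ← hi]; exact Equiv.Perm.sameCycle_apply_right.2 .rfl
      | succ n ih =>
        rw [pow_succ', Equiv.Perm.mul_apply]
        by_cases hj : (σ ^ (n + 1)) j = j
        · rw [hj, ← hi]; exact Equiv.Perm.sameCycle_apply_right.2 .rfl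
        · rw [← hk _ _ hj]
          · exact Equiv.Perm.sameCycle_apply_right.2 ih
          · intro he
            exact hσ (he ▸ Equiv.Perm.sameCycle_pow_left.2 .rfl)
    have := key (orderOf σ - 1)
    rwa [Nat.sub_add_cancel (orderOf_pos σ), pow_orderOf_eq_one, Equiv.Perm.one_apply] at this

namespace CrossingGraph

variable (G : CrossingGraph)

theorem rot_apply (c : G.Crossing) (i : Fin 4) : G.rot (c, i) = (c, i + 1) := rfl

def edgeOf (h : G.End) : G.Edge := Quotient.mk _ h

def faceOf (h : G.End) : G.Face := Quotient.mk _ h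

theorem edgeOf_glue (h : G.End) : G.edgeOf (G.glue h) = G.edgeOf h :=
  Quotient.sound (Equiv.Perm.sameCycle_apply_left.2 .rfl)

theorem faceOf_glue (h : G.End) : G.faceOf (G.glue h) = G.faceOf (G.rot h) := by
  refine Quotient.sound (Equiv.Perm.sameCycle_apply_left.1 ?_)
  rw [Equiv.Perm.mul_apply, G.glue_glue]

theorem edgeOf_eq_iff {h k : G.End} : G.edgeOf k = G.edgeOf h ↔ k = h ∨ k = G.glue h := by
  constructor
  · intro e
    obtain ⟨n, hn⟩ := (Quotient.exact e : G.glue.SameCycle k h).symm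
    have hsq : G.glue ^ (2 : ℤ) = 1 := by
      ext1 x; rw [zpow_two]; simp [G.glue_glue]
    rcases Int.even_or_odd' n with ⟨m, rfl | rfl⟩
    · left; rw [zpow_mul, hsq] at hn; simpa using hn.symm
    · right; rw [zpow_add, zpow_mul, hsq] at hn; simpa using hn.symm
  · rintro (rfl | rfl)
    · rfl
    · exact G.edgeOf_glue h

/-- The cellular coboundary from functions on faces to functions on edges, modulo 2. -/
def faceCob : (G.Face → ZMod 2) →ₗ[ZMod 2] (G.Edge → ZMod 2) where
  toFun f := Quotient.lift (fun h : G.End => f (G.faceOf h) + f (G.faceOf (G.glue h))) (by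
    intro a b hab
    rcases G.edgeOf_eq_iff.1 (Quotient.sound hab : G.edgeOf a = G.edgeOf b) with rfl | rfl
    · rfl
    · simp only [G.glue_glue, add_comm])
  map_add' f g := by
    ext e; induction e using Quotient.ind
    simp only [Quotient.lift_mk, Pi.add_apply]; ring
  map_smul' f g := by
    ext e; induction e using Quotient.ind
    simp only [Quotient.lift_mk, Pi.smul_apply, smul_eq_mul, RingHom.id_apply]; ring

theorem faceCob_apply (f : G.Face → ZMod 2) (h : G.End) :
    G.faceCob f (G.edgeOf h) = f (G.faceOf h) + f (G.faceOf (G.glue h)) := rfl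

/-- The cellular boundary from edges to crossings, modulo 2. -/
def edgeBd : (G.Edge → ZMod 2) →ₗ[ZMod 2] (G.Crossing → ZMod 2) where
  toFun g c := ∑ i : Fin 4, g (G.edgeOf (c, i))
  map_add' f g := by ext c; simp [Finset.sum_add_distrib]
  map_smul' f g := by ext c; simp [Finset.mul_sum]

theorem edgeBd_apply (g : G.Edge → ZMod 2) (c : G.Crossing) :
    G.edgeBd g c = ∑ i : Fin 4, g (G.edgeOf (c, i)) := rfl

theorem edgeBd_faceCob (f : G.Face → ZMod 2) : G.edgeBd (G.faceCob f) = 0 := by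
  ext c
  have h2 : ∀ a : ZMod 2, a + a = 0 := by decide
  simp only [edgeBd_apply, faceCob_apply, faceOf_glue, rot_apply, Finset.sum_add_distrib]
  have := Equiv.sum_comp (Equiv.addRight (1 : Fin 4)) (fun i => f (G.faceOf (c, i)))
  simp only [Equiv.coe_addRight] at this
  rw [this, h2]
  rfl

open Classical in
theorem edgeBd_single (h : G.End) :
    G.edgeBd (Pi.single (G.edgeOf h) 1) = Pi.single h.1 1 + Pi.single (G.glue h).1 1 := by
  have aux : ∀ (k : G.End) (c : G.Crossing),
      (∑ i : Fin 4, if (c, i) = k then (1 : ZMod 2) else 0) = if c = k.1 then 1 else 0 := by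
    rintro ⟨k, j⟩ c
    by_cases hc : c = k
    · subst hc; simp
    · simp [hc]
  ext c
  simp only [edgeBd_apply, Pi.single_apply, Pi.add_apply]
  rw [← aux h, ← aux (G.glue h), ← Finset.sum_add_distrib]
  refine Finset.sum_congr rfl fun i _ => ?_
  simp only [G.edgeOf_eq_iff]
  by_cases h1 : (c, i) = h
  · rw [h1]; simp [(G.glue_ne h).symm]
  · simp [h1]

theorem ker_faceCob_glue {f : G.Face → ZMod 2} (hf : G.faceCob f = 0) (h : G.End) :
    f (G.faceOf (G.glue h)) = f (G.faceOf h) := by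
  have h0 : f (G.faceOf h) + f (G.faceOf (G.glue h)) = 0 := congrFun hf (G.edgeOf h)
  generalize f (G.faceOf (G.glue h)) = a at *
  generalize f (G.faceOf h) = b at *
  revert a b; decide

theorem ker_faceCob_const {f : G.Face → ZMod 2} (hf : G.faceCob f = 0) (c : G.Crossing)
    (i : Fin 4) : f (G.faceOf (c, i)) = f (G.faceOf (c, 0)) := by
  have hrot : ∀ i, f (G.faceOf (c, i + 1)) = f (G.faceOf (c, i)) := by
    intro i
    rw [← G.ker_faceCob_glue hf (c, i), faceOf_glue, rot_apply]
  have h0 := hrot 0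
  have h1 := hrot 1
  have h2 := hrot 2
  fin_cases i
  · rfl
  · exact h0
  · exact h1.trans h0
  · exact h2.trans (h1.trans h0)

theorem finrank_ker_faceCob_le :
    Module.finrank (ZMod 2) (LinearMap.ker G.faceCob) ≤ Nat.card G.Component := by
  classical
  let Φ : LinearMap.ker G.faceCob →ₗ[ZMod 2] (G.Component → ZMod 2) :=
    { toFun := fun f => Quotient.lift (fun c : G.Crossing => f.1 (G.faceOf (c, 0))) (by
        intro a b hab
        induction hab with
        | rel a b hab =>
          obtain ⟨i, j, hij⟩ := hab
          rw [← G.ker_faceCob_const f.2 a i, ← G.ker_faceCob_const f.2 b j, ← hij,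
            G.ker_faceCob_glue f.2]
        | refl => rfl
        | symm _ _ _ ih => exact ih.symm
        | trans _ _ _ _ _ ih1 ih2 => exact ih1.trans ih2)
      map_add' := by
        intro f g; ext e; induction e using Quotient.ind; rfl
      map_smul' := by
        intro f g; ext e; induction e using Quotient.ind; rfl }
  have hΦ : Function.Injective Φ := by
    intro f g hfg
    ext e
    induction e using Quotient.ind with
    | _ h =>
      obtain ⟨c, i⟩ := h
      change f.1 (G.faceOf (c, i)) = g.1 (G.faceOf (c, i))
      rw [G.ker_faceCob_const f.2, G.ker_faceCob_const g.2]
      exact congrFun hfg (Quotient.mk _ c)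
  have := LinearMap.finrank_le_finrank_of_injective hΦ
  rwa [Module.finrank_fintype_fun_eq_card, ← Nat.card_eq_fintype_card] at this

theorem finrank_dualAnnihilator_edgeBd_le :
    Module.finrank (ZMod 2) (LinearMap.range G.edgeBd).dualAnnihilator ≤
      Nat.card G.Component := by
  classical
  let Φ : (LinearMap.range G.edgeBd).dualAnnihilator →ₗ[ZMod 2] (G.Component → ZMod 2) :=
    { toFun := fun l => Quotient.lift (fun c : G.Crossing => l.1 (Pi.single c 1)) (by
        intro a b hab
        induction hab with
        | rel a b hab =>
          obtain ⟨i, j, hij⟩ := hab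
          have h := (Submodule.mem_dualAnnihilator _).1 l.2 _
            (LinearMap.mem_range_self G.edgeBd (Pi.single (G.edgeOf (a, i)) 1))
          rw [edgeBd_single, map_add, hij] at h
          dsimp only at h ⊢
          generalize l.1 (Pi.single a 1) = x at *
          generalize l.1 (Pi.single b 1) = y at *
          revert x y; decide
        | refl => rfl
        | symm _ _ _ ih => exact ih.symm
        | trans _ _ _ _ _ ih1 ih2 => exact ih1.trans ih2)
      map_add' := by
        intro f g; ext e; induction e using Quotient.ind; rfl
      map_smul' := by
        intro f g; ext e; induction e using Quotient.ind; rfl }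
  have hΦ : Function.Injective Φ := by
    intro f g hfg
    apply Subtype.ext
    refine LinearMap.pi_ext' fun c => LinearMap.ext_ring ?_
    exact congrFun hfg (Quotient.mk _ c)
  have := LinearMap.finrank_le_finrank_of_injective hΦ
  rwa [Module.finrank_fintype_fun_eq_card, ← Nat.card_eq_fintype_card] at this

end CrossingGraph

namespace LinkDiagram

variable (D : LinkDiagram)

/-- The faces of a link diagram can be two-coloured; in terms of ends: -/
theorem exists_colouring : ∃ o : D.End → ZMod 2,
    (∀ h, o (D.glue h) = o h + 1) ∧ ∀ c i, o (c, i + 1) = o (c, i) + 1 := by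
  classical
  have hle : LinearMap.range D.faceCob ≤ LinearMap.ker D.edgeBd := by
    rintro _ ⟨f, rfl⟩
    exact D.edgeBd_faceCob f
  have h1 := LinearMap.finrank_range_add_finrank_ker D.faceCob
  have h2 := LinearMap.finrank_range_add_finrank_ker D.edgeBd
  have h3 := Subspace.finrank_add_finrank_dualAnnihilator_eq (LinearMap.range D.edgeBd)
  have h4 := D.finrank_ker_faceCob_le
  have h5 := D.finrank_dualAnnihilator_edgeBd_le
  have h6 := D.planar
  rw [Module.finrank_fintype_fun_eq_card, ← Nat.card_eq_fintype_card] at h1 h2 h3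
  have heq := Submodule.eq_of_le_of_finrank_le hle (by omega)
  have hone : (fun _ => 1 : D.Edge → ZMod 2) ∈ LinearMap.range D.faceCob := by
    rw [heq, LinearMap.mem_ker]
    ext c
    rw [CrossingGraph.edgeBd_apply]
    simp only [Finset.sum_const, Finset.card_univ, Fintype.card_fin, Pi.zero_apply]
    exact (by decide : 4 • (1 : ZMod 2) = 0)
  obtain ⟨f, hf⟩ := hone
  have hg : ∀ h, f (D.faceOf (D.glue h)) = f (D.faceOf h) + 1 := by
    intro h
    have h1 : f (D.faceOf h) + f (D.faceOf (D.glue h)) = 1 := congrFun hf (D.edgeOf h)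
    generalize f (D.faceOf (D.glue h)) = a at *
    generalize f (D.faceOf h) = b at *
    revert a b; decide
  refine ⟨fun h => f (D.faceOf h), hg, fun c i => ?_⟩
  dsimp only
  rw [← hg, CrossingGraph.faceOf_glue, CrossingGraph.rot_apply]

end LinkDiagram

namespace CrossingGraph

variable (G : CrossingGraph)

/-- The arcs replacing a crossing.  A `0`-resolved crossing joins the ends `0, 1` and the ends `2, 3`;
a `1`-resolved crossing joins the ends `0, 3` and the ends `1, 2`.  (Travelling towards the crossing
along the over-strand, `0`-resolving turns left, whichever end one starts from.) -/
def arc (resolved : Prop) [Decidable resolved] : Fin 4 → Fin 4 :=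
  if resolved then ![3, 2, 1, 0] else ![1, 0, 3, 2]

/-- In the complete resolution in which exactly the crossings in `x` are `1`-resolved: the other end
of the arc at `h` that replaces the crossing. -/
def partner (x : Finset G.Crossing) (h : G.End) : G.End := (h.1, arc (h.1 ∈ x) h.2)

/-- The points of a complete resolution that are recorded: the ends of the crossings, and one
point on every circle without crossings. -/
abbrev Point : Type := G.End ⊕ Fin G.freeCircles

/-- Two points lie on the same circle of the complete resolution given by `x`. -/
def circleSetoid (x : Finset G.Crossing) : Setoid G.Point :=
  Relation.EqvGen.setoid fun p q =>
    ∃ h : G.End, p = Sum.inl h ∧ (q = Sum.inl (G.glue h) ∨ q = Sum.inl (G.partner x h))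

/-- The circles of the complete resolution `D(x)`. -/
abbrev Circle (x : Finset G.Crossing) : Type := Quotient (G.circleSetoid x)

/-- The circle of `D(x)` through a given point. -/
def circleOf (x : Finset G.Crossing) (p : G.Point) : G.Circle x := Quotient.mk _ p

/-- An end of a crossing, as a point. -/
def pt (c : G.Crossing) (i : Fin 4) : G.Point := Sum.inl (c, i)

noncomputable instance (x : Finset G.Crossing) : Fintype (G.Circle x) := Fintype.ofFinite _

noncomputable instance (x : Finset G.Crossing) : DecidableEq (G.Circle x) := Classical.decEq _

variable {G}

theorem rel_glue (x : Finset G.Crossing) (h : G.End) :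
    G.circleSetoid x (Sum.inl h) (Sum.inl (G.glue h)) :=
  .rel _ _ ⟨h, rfl, .inl rfl⟩

theorem rel_partner (x : Finset G.Crossing) (h : G.End) :
    G.circleSetoid x (Sum.inl h) (Sum.inl (G.partner x h)) :=
  .rel _ _ ⟨h, rfl, .inr rfl⟩

theorem circleSetoid_le {x : Finset G.Crossing} {r : Setoid G.Point}
    (h1 : ∀ h, r (Sum.inl h) (Sum.inl (G.glue h)))
    (h2 : ∀ h, r (Sum.inl h) (Sum.inl (G.partner x h))) : G.circleSetoid x ≤ r := by
  intro p q hpq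
  induction hpq with
  | rel a b hab =>
    obtain ⟨h, rfl, rfl | rfl⟩ := hab
    · exact h1 h
    · exact h2 h
  | refl => exact r.refl' _
  | symm _ _ _ ih => exact r.symm' ih
  | trans _ _ _ _ _ ih1 ih2 => exact r.trans' ih1 ih2

theorem partner_of_notMem {x : Finset G.Crossing} {c : G.Crossing} (hc : c ∉ x) (i : Fin 4) :
    G.partner x (c, i) = (c, ![1, 0, 3, 2] i) := by simp [partner, arc, hc]

theorem partner_of_mem {x : Finset G.Crossing} {c : G.Crossing} (hc : c ∈ x) (i : Fin 4) :
    G.partner x (c, i) = (c, ![3, 2, 1, 0] i) := by simp [partner, arc, hc]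

theorem partner_partner (x : Finset G.Crossing) (h : G.End) :
    G.partner x (G.partner x h) = h := by
  obtain ⟨c, i⟩ := h
  by_cases hc : c ∈ x
  · rw [partner_of_mem hc, partner_of_mem hc]; fin_cases i <;> rfl
  · rw [partner_of_notMem hc, partner_of_notMem hc]; fin_cases i <;> rfl

theorem partner_congr {x y : Finset G.Crossing} {h : G.End} (hxy : h.1 ∈ x ↔ h.1 ∈ y) :
    G.partner x h = G.partner y h := by
  simp [partner, arc, hxy]

/-- At each crossing the four ends are joined in the pairs containing `0` and `2`. -/
theorem rel_pt_zero_or_two (x : Finset G.Crossing) (c : G.Crossing) (i : Fin 4) :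
    G.circleSetoid x (G.pt c i) (G.pt c 0) ∨ G.circleSetoid x (G.pt c i) (G.pt c 2) := by
  have h := rel_partner x (c, i)
  by_cases hc : c ∈ x
  · rw [partner_of_mem hc] at h
    fin_cases i
    · exact .inl (Setoid.refl' _ _)
    · exact .inr h
    · exact .inr (Setoid.refl' _ _)
    · exact .inl h
  · rw [partner_of_notMem hc] at h
    fin_cases i
    · exact .inl (Setoid.refl' _ _)
    · exact .inl h
    · exact .inr (Setoid.refl' _ _)
    · exact .inr h

/-- The resolutions `x` and `y` differ exactly at the crossing `a`. -/
def DifferAt (a : G.Crossing) (x y : Finset G.Crossing) : Prop :=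
  (∀ c, c ≠ a → (c ∈ x ↔ c ∈ y)) ∧ (a ∈ x ↔ a ∉ y)

theorem DifferAt.symm {a : G.Crossing} {x y : Finset G.Crossing} (h : DifferAt a x y) :
    DifferAt a y x := ⟨fun c hc => (h.1 c hc).symm, by have := h.2; tauto⟩

theorem differAt_insert {a : G.Crossing} {x : Finset G.Crossing} (h : a ∉ x) :
    DifferAt a x (insert a x) := ⟨fun c hc => by simp [hc], by simp [h]⟩

/-- If the two strands at `a` lie on one circle for `x` and for `y`, all four ends do. -/
theorem DifferAt.rel_all {a : G.Crossing} {x y : Finset G.Crossing} (_h : DifferAt a x y)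
    (hx : G.circleSetoid x (G.pt a 0) (G.pt a 2)) (i j : Fin 4) :
    G.circleSetoid x (G.pt a i) (G.pt a j) := by
  have key : ∀ i, G.circleSetoid x (G.pt a i) (G.pt a 0) := fun i =>
    (rel_pt_zero_or_two x a i).elim id fun h => Setoid.trans' _ h (Setoid.symm' _ hx)
  exact Setoid.trans' _ (key i) (Setoid.symm' _ (key j))

end CrossingGraph

namespace LinkDiagram

open CrossingGraph

variable {D : LinkDiagram}

/-- Changing one resolution joins two circles or cuts one circle in two. -/
theorem rel_iff_not_rel {a : D.Crossing} {x y : Finset D.Crossing} (hxy : DifferAt a x y) :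
    D.circleSetoid x (D.pt a 0) (D.pt a 2) ↔ ¬ D.circleSetoid y (D.pt a 0) (D.pt a 2) := by
  obtain ⟨o, hglue, hrot⟩ := D.exists_colouring
  have h01 : ∀ c, o (c, 1) = o (c, 0) + 1 := fun c => hrot c 0
  have h12 : ∀ c, o (c, 2) = o (c, 1) + 1 := fun c => hrot c 1
  have h23 : ∀ c, o (c, 3) = o (c, 2) + 1 := fun c => hrot c 2
  have two : ∀ t : ZMod 2, t + 1 + 1 = t := by decide
  have ne1 : ∀ t : ZMod 2, t + 1 ≠ t := by decide
  have hp : ∀ x h, o (D.partner x h) = o h + 1 := by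
    rintro x ⟨c, i⟩
    by_cases hc : c ∈ x
    · rw [partner_of_mem hc]
      fin_cases i <;> simp [h01, h12, h23, two]
    · rw [partner_of_notMem hc]
      fin_cases i <;> simp [h01, h12, h23, two]
  set s := o (a, 0) with hs
  let π : Finset D.Crossing → Equiv.Perm {h : D.End // o h = s} := fun x =>
    { toFun := fun h => ⟨D.glue (D.partner x h.1), by rw [hglue, hp, two, h.2]⟩
      invFun := fun h => ⟨D.partner x (D.glue h.1), by rw [hp, hglue, two, h.2]⟩
      left_inv := fun h => Subtype.ext (by simp [D.glue_glue, partner_partner])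
      right_inv := fun h => Subtype.ext (by simp [D.glue_glue, partner_partner]) }
  have hout : ∀ h, o h ≠ s → o (D.glue h) = s := by
    intro h hh
    rw [hglue]
    exact (by decide : ∀ u v : ZMod 2, u ≠ v → u + 1 = v) _ _ hh
  classical
  let inn : D.End → {h : D.End // o h = s} := fun h =>
    if hh : o h = s then ⟨h, hh⟩ else ⟨D.glue h, hout h hh⟩
  have inn_pos : ∀ h (hh : o h = s), inn h = ⟨h, hh⟩ := fun h hh => dif_pos hh
  have inn_neg : ∀ h (hh : ¬ o h = s), inn h = ⟨D.glue h, hout h hh⟩ := fun h hh => dif_neg hh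
  have inn_glue : ∀ h, inn (D.glue h) = inn h := by
    intro h
    by_cases hh : o h = s
    · rw [inn_pos h hh, inn_neg]
      · exact Subtype.ext (D.glue_glue h)
      · rw [hglue, hh]; exact ne1 s
    · rw [inn_neg h hh, inn_pos]
  have inn_partner : ∀ x h, o h = s → inn (D.partner x h) = π x (inn h) := by
    intro x h hh
    rw [inn_pos h hh, inn_neg]
    · rfl
    · rw [hp, hh]; exact ne1 s
  have main : ∀ x h k, D.circleSetoid x (Sum.inl h) (Sum.inl k) ↔
      (π x).SameCycle (inn h) (inn k) := by
    intro x h k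
    constructor
    · intro hr
      let r : Setoid D.Point :=
        { r := fun p q => match p, q with
            | .inl h, .inl k => (π x).SameCycle (inn h) (inn k)
            | .inr m, .inr n => m = n
            | _, _ => False
          iseqv := by
            refine ⟨?_, ?_, ?_⟩
            · rintro (h | h)
              · exact .refl _ _
              · rfl
            · rintro (h | h) (k | k) hk
              · exact hk.symm
              · exact hk
              · exact hk
              · exact hk.symm
            · rintro (h | h) (k | k) (l | l) hk hl
              · exact hk.trans hl
              · exact hl
              · exact hk.elim
              · exact hk.elim
              · exact hk.elim
              · exact hk.elim
              · exact hl.elim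
              · exact hk.trans hl }
      have hle : D.circleSetoid x ≤ r := by
        refine circleSetoid_le (fun h => ?_) (fun h => ?_)
        · change (π x).SameCycle (inn h) (inn (D.glue h))
          rw [inn_glue]
        · change (π x).SameCycle (inn h) (inn (D.partner x h))
          by_cases hh : o h = s
          · rw [inn_partner x h hh]
            exact Equiv.Perm.sameCycle_apply_right.2 .rfl
          · have hk : o (D.partner x h) = s := by
              rw [hp, ← hglue]; exact hout h hh
            have := inn_partner x _ hk
            rw [partner_partner] at this
            rw [this]
            exact Equiv.Perm.sameCycle_apply_left.2 .rfl
      exact hle hr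
    · intro hc
      have hin : ∀ h, D.circleSetoid x (Sum.inl h) (Sum.inl (inn h).1) := by
        intro h
        by_cases hh : o h = s
        · rw [inn_pos h hh]
        · rw [inn_neg h hh]; exact rel_glue x h
      have hpow : ∀ (n : ℕ) (u : {h : D.End // o h = s}),
          D.circleSetoid x (Sum.inl u.1) (Sum.inl ((π x ^ n) u).1) := by
        intro n u
        induction n with
        | zero => exact Setoid.refl' _ _
        | succ n ih =>
          rw [pow_succ', Equiv.Perm.mul_apply]
          exact Setoid.trans' _ ih (Setoid.trans' _ (rel_partner x _) (rel_glue x _))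
      obtain ⟨n, -, -, hn⟩ := hc.exists_pow_eq''
      refine Setoid.trans' _ (hin h) (Setoid.trans' _ ?_ (Setoid.symm' _ (hin k)))
      rw [← hn]
      exact hpow n _
  have o2 : o (a, 2) = s := by rw [h12, h01, two]
  have hne : (⟨(a, 0), rfl⟩ : {h : D.End // o h = s}) ≠ ⟨(a, 2), o2⟩ := by
    intro h
    have := congrArg (fun u : {h : D.End // o h = s} => u.1.2) h
    exact (by decide : (0 : Fin 4) ≠ 2) this
  have hπ : π y = π x * Equiv.swap ⟨(a, 0), rfl⟩ ⟨(a, 2), o2⟩ := by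
    have e0 : D.partner y (a, 0) = D.partner x (a, 2) := by
      by_cases hx : a ∈ x
      · rw [partner_of_mem hx, partner_of_notMem (hxy.2.1 hx)]; rfl
      · rw [partner_of_notMem hx, partner_of_mem (by have := hxy.2; tauto)]; rfl
    have e2 : D.partner y (a, 2) = D.partner x (a, 0) := by
      by_cases hx : a ∈ x
      · rw [partner_of_mem hx, partner_of_notMem (hxy.2.1 hx)]; rfl
      · rw [partner_of_notMem hx, partner_of_mem (by have := hxy.2; tauto)]; rfl
    ext1 ⟨⟨c, i⟩, hci⟩
    rw [Equiv.Perm.mul_apply]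
    by_cases hc : c = a
    · subst hc
      fin_cases i
      · change π y ⟨(c, 0), rfl⟩ = π x (Equiv.swap ⟨(c, 0), rfl⟩ ⟨(c, 2), o2⟩ ⟨(c, 0), rfl⟩)
        rw [Equiv.swap_apply_left]
        exact Subtype.ext (congrArg D.glue e0)
      · exact absurd hci (by simp only [Fin.mk_one]; rw [h01]; exact ne1 _)
      · change π y ⟨(c, 2), o2⟩ = π x (Equiv.swap ⟨(c, 0), rfl⟩ ⟨(c, 2), o2⟩ ⟨(c, 2), o2⟩)
        rw [Equiv.swap_apply_right]
        exact Subtype.ext (congrArg D.glue e2)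
      · exact absurd hci (by
          change ¬ o (c, 3) = s
          rw [h23, o2]; exact ne1 _)
    · rw [Equiv.swap_apply_of_ne_of_ne]
      · exact Subtype.ext (congrArg D.glue (partner_congr (hxy.1 c hc).symm))
      · intro h; exact hc (congrArg (fun u : {h : D.End // o h = s} => u.1.1) h)
      · intro h; exact hc (congrArg (fun u : {h : D.End // o h = s} => u.1.1) h)
  unfold pt
  rw [main, main, inn_pos _ rfl, inn_pos _ o2, hπ]
  exact sameCycle_mul_swap_iff _ hne

/-- If `a` joins two different circles of `x`, the circles of `y` are those of `x` with the two joined. -/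
theorem rel_of_not_rel {a : D.Crossing} {x y : Finset D.Crossing} (hxy : DifferAt a x y)
    (h : ¬ D.circleSetoid x (D.pt a 0) (D.pt a 2)) (p q : D.Point) :
    D.circleSetoid y p q ↔ D.circleSetoid x p q ∨
      ((D.circleSetoid x p (D.pt a 0) ∨ D.circleSetoid x p (D.pt a 2)) ∧
        (D.circleSetoid x q (D.pt a 0) ∨ D.circleSetoid x q (D.pt a 2))) := by
  have hy : D.circleSetoid y (D.pt a 0) (D.pt a 2) := by
    by_contra hy; exact h ((rel_iff_not_rel hxy).2 hy)
  have hle : D.circleSetoid x ≤ D.circleSetoid y := by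
    refine circleSetoid_le (rel_glue y) ?_
    rintro ⟨c, i⟩
    by_cases hc : c = a
    · subst hc; exact hxy.symm.rel_all hy _ _
    · rw [partner_congr (hxy.1 c hc)]; exact rel_partner y _
  constructor
  · let r : Setoid D.Point :=
      { r := fun p q => D.circleSetoid x p q ∨
          ((D.circleSetoid x p (D.pt a 0) ∨ D.circleSetoid x p (D.pt a 2)) ∧
            (D.circleSetoid x q (D.pt a 0) ∨ D.circleSetoid x q (D.pt a 2)))
        iseqv := by
          have hs := fun {p q : D.Point} => (D.circleSetoid x).symm' (x := p) (y := q)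
          have ht := fun {p q r : D.Point} => (D.circleSetoid x).trans' (x := p) (y := q) (z := r)
          refine ⟨fun p => .inl (Setoid.refl' _ p), ?_, ?_⟩
          · rintro p q (h | ⟨h1, h2⟩)
            · exact .inl (hs h)
            · exact .inr ⟨h2, h1⟩
          · rintro p q r (h | ⟨h1, h2⟩) (h' | ⟨h3, h4⟩)
            · exact .inl (ht h h')
            · exact .inr ⟨h3.imp (ht h) (ht h), h4⟩
            · exact .inr ⟨h1, h2.imp (ht (hs h')) (ht (hs h'))⟩
            · exact .inr ⟨h1, h4⟩ }
    have hle' : D.circleSetoid y ≤ r := by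
      refine circleSetoid_le (fun h => .inl (rel_glue x h)) ?_
      rintro ⟨c, i⟩
      by_cases hc : c = a
      · subst hc; exact .inr ⟨rel_pt_zero_or_two x _ _, rel_pt_zero_or_two x _ _⟩
      · rw [partner_congr (hxy.symm.1 c hc)]; exact .inl (rel_partner x _)
    intro hpq
    exact hle' hpq
  · rintro (h | ⟨h1, h2⟩)
    · exact hle h
    · have h1' : D.circleSetoid y p (D.pt a 0) :=
        h1.elim (fun h => hle h) fun h => Setoid.trans' _ (hle h) (Setoid.symm' _ hy)
      have h2' : D.circleSetoid y q (D.pt a 0) :=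
        h2.elim (fun h => hle h) fun h => Setoid.trans' _ (hle h) (Setoid.symm' _ hy)
      exact Setoid.trans' _ h1' (Setoid.symm' _ h2')

end LinkDiagram

/-! ### The Frobenius algebra -/

/-- The algebra `V = R[1, u]` with `u * u = 0`, free of rank two over `R` on `1` and `u`.  (The
coefficient ring will be `ℤ`.) -/
def FrobeniusV (R : Type) [CommRing R] : Type := DualNumber R

namespace FrobeniusV

open scoped TensorProduct

variable {R : Type} [CommRing R]

instance : CommRing (FrobeniusV R) := inferInstanceAs (CommRing (DualNumber R))

instance : Algebra R (FrobeniusV R) := inferInstanceAs (Algebra R (DualNumber R))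

/-- The basis element `u`. -/
def u : FrobeniusV R := (DualNumber.eps : DualNumber R)

/-- The coefficient of `1`. -/
def coeffOne : FrobeniusV R →ₗ[R] R := (TrivSqZeroExt.fstHom R R R).toLinearMap

/-- The coefficient of `u`. -/
def coeffU : FrobeniusV R →ₗ[R] R := TrivSqZeroExt.sndHom R R

/-- The comultiplication `1 ↦ 1 ⊗ u + u ⊗ 1`, `u ↦ u ⊗ u`. -/
noncomputable def comul : FrobeniusV R →ₗ[R] FrobeniusV R ⊗[R] FrobeniusV R :=
  coeffOne.smulRight (1 ⊗ₜ u + u ⊗ₜ 1) + coeffU.smulRight (u ⊗ₜ u)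

theorem coeffOne_one : coeffOne (1 : FrobeniusV R) = 1 := rfl
theorem coeffOne_u : coeffOne (u : FrobeniusV R) = 0 := rfl
theorem coeffU_one : coeffU (1 : FrobeniusV R) = 0 := rfl
theorem coeffU_u : coeffU (u : FrobeniusV R) = 1 := rfl

theorem u_mul_u : (u : FrobeniusV R) * u = 0 := DualNumber.eps_mul_eps

theorem comul_one : comul (1 : FrobeniusV R) = 1 ⊗ₜ u + u ⊗ₜ 1 := by
  simp [comul, coeffOne_one, coeffU_one]

theorem comul_u : comul (u : FrobeniusV R) = u ⊗ₜ u := by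
  simp [comul, coeffOne_u, coeffU_u]

theorem eq_add (v : FrobeniusV R) : v = coeffOne v • (1 : FrobeniusV R) + coeffU v • u := by
  refine TrivSqZeroExt.ext ?_ ?_
  · change v.fst = v.fst • (1 : R) + v.snd • (0 : R); simp
  · change v.snd = v.fst • (0 : R) + v.snd • (1 : R); simp

theorem comul_apply (v : FrobeniusV R) :
    comul v = ((1 : FrobeniusV R) ⊗ₜ[R] u + u ⊗ₜ[R] 1) * (v ⊗ₜ[R] 1) := by
  conv_lhs => rw [eq_add v]
  conv_rhs => rw [eq_add v]
  rw [map_add, map_smul, map_smul, comul_one, comul_u, TensorProduct.add_tmul, mul_add,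
    ← TensorProduct.smul_tmul', ← TensorProduct.smul_tmul', mul_smul_comm, mul_smul_comm]
  simp [add_mul, u_mul_u]

end FrobeniusV

/-! ### The cube of resolutions -/

namespace CrossingGraph

open scoped TensorProduct

variable (R : Type) [CommRing R] (G : CrossingGraph)

/-- `V^{⊗ k}`, with one tensor factor for every circle of the complete resolution `D(x)`. -/
abbrev States (x : Finset G.Crossing) : Type := ⨂[R] _ : G.Circle x, FrobeniusV R

/-- The factor inclusion `v ↦ 1 ⊗ ⋯ ⊗ v ⊗ ⋯ ⊗ 1` at a circle `c`. -/
noncomputable def single {x : Finset G.Crossing} (c : G.Circle x) :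
    FrobeniusV R →ₐ[R] G.States R x :=
  PiTensorProduct.singleAlgHom (R := R) (A := fun _ : G.Circle x => FrobeniusV R) c

/-- A circle of `D(x)` that shares a point with the given circle of `D(y)`.  For a circle that is not
changed from `D(y)` to `D(x)` this is the circle itself, and for two circles that are fused it is the
circle that they are fused into. -/
noncomputable def transport (y x : Finset G.Crossing) (c : G.Circle y) : G.Circle x :=
  G.circleOf x c.out

/-- The map that multiplies the tensor factors of the circles that are fused, and is the identity on
the other factors: `⨂ v_c ↦ ∏ single (transport c) v_c`. -/
noncomputable def mergeMap (y x : Finset G.Crossing) : G.States R y →ₗ[R] G.States R x :=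
  PiTensorProduct.lift
    ((MultilinearMap.mkPiAlgebra R (G.Circle y) (G.States R x)).compLinearMap
      fun c => (G.single R (G.transport y x c)).toLinearMap)

/-- The map `V ⊗ V → V^{⊗ k}` that places the two tensor factors at the circles `c` and `c'`. -/
noncomputable def place {x : Finset G.Crossing} (c c' : G.Circle x) :
    FrobeniusV R ⊗[R] FrobeniusV R →ₐ[R] G.States R x :=
  Algebra.TensorProduct.lift (G.single R c) (G.single R c') (fun _ _ => Commute.all _ _)

/-- The map that applies the comultiplication to the tensor factor of the circle through the crossing
`a`, which bifurcates into the two circles of `D(x)` through the ends `0` and `2` of `a`, and is the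
identity on the other factors. -/
noncomputable def splitMap (a : G.Crossing) (y x : Finset G.Crossing) :
    G.States R y →ₗ[R] G.States R x :=
  PiTensorProduct.lift
    ((MultilinearMap.mkPiAlgebra R (G.Circle y) (G.States R x)).compLinearMap
      fun c => if c = G.circleOf y (G.pt a 0) then
          (G.place R (G.circleOf x (G.pt a 0)) (G.circleOf x (G.pt a 2))).toLinearMap ∘ₗ
            FrobeniusV.comul
        else (G.single R (G.transport y x c)).toLinearMap)

/-- The map along the edge of the cube from `y` to `x = y ∪ {a}`: the circles of `D(y)` through the two
`0`-resolving arcs at `a` are fused if they are different, otherwise the circle bifurcates. -/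
noncomputable def edgeMap (a : G.Crossing) (y x : Finset G.Crossing) :
    G.States R y →ₗ[R] G.States R x :=
  if G.circleOf y (G.pt a 0) = G.circleOf y (G.pt a 2) then G.splitMap R a y x
  else G.mergeMap R y x

variable {R G}

theorem circleOf_eq_iff {x : Finset G.Crossing} {p q : G.Point} :
    G.circleOf x p = G.circleOf x q ↔ G.circleSetoid x p q := Quotient.eq

variable (R) in
/-- The generator `u` in the factor of the circle through a point. -/
noncomputable def gen (x : Finset G.Crossing) (p : G.Point) : G.States R x :=
  G.single R (G.circleOf x p) (FrobeniusV.u : FrobeniusV R)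

theorem gen_congr {x : Finset G.Crossing} {p q : G.Point} (h : G.circleSetoid x p q) :
    gen R x p = gen R x q := by
  rw [gen, gen, circleOf_eq_iff.2 h]

theorem gen_mul_self (x : Finset G.Crossing) (p : G.Point) : gen R x p * gen R x p = 0 := by
  rw [gen, ← map_mul, FrobeniusV.u_mul_u, map_zero]

variable (R) in
/-- `mergeMap` as a homomorphism of algebras. -/
noncomputable def push (y x : Finset G.Crossing) : G.States R y →ₐ[R] G.States R x :=
  PiTensorProduct.liftAlgHom
    ((MultilinearMap.mkPiAlgebra R (G.Circle y) (G.States R x)).compLinearMap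
      fun c => (G.single R (G.transport y x c)).toLinearMap)
    (by simp)
    (by intro v w; simp [Finset.prod_mul_distrib])

theorem push_tprod (y x : Finset G.Crossing) (v : G.Circle y → FrobeniusV R) :
    push R y x (PiTensorProduct.tprod R v) = ∏ c, G.single R (G.transport y x c) (v c) := by
  change PiTensorProduct.lift _ (PiTensorProduct.tprod R v) = _
  rw [PiTensorProduct.lift.tprod]
  rfl

theorem mergeMap_apply (y x : Finset G.Crossing) (z : G.States R y) :
    G.mergeMap R y x z = push R y x z := rfl

theorem push_gen (y x : Finset G.Crossing) (p : G.Point) :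
    push R y x (gen R y p) = gen R x (G.circleOf y p).out := by
  rw [gen, single, PiTensorProduct.singleAlgHom_apply, push_tprod,
    Finset.prod_eq_single (G.circleOf y p)]
  · simp [gen, transport]
  · intro c _ hc
    simp [Pi.mulSingle_eq_of_ne hc]
  · simp

theorem splitMap_apply (a : G.Crossing) (y x : Finset G.Crossing)
    (ht : (gen R x (G.pt a 0) + gen R x (G.pt a 2)) *
      G.single R (G.circleOf x (G.pt a 0)) (FrobeniusV.u : FrobeniusV R) =
      (gen R x (G.pt a 0) + gen R x (G.pt a 2)) *
      G.single R (G.transport y x (G.circleOf y (G.pt a 0))) (FrobeniusV.u : FrobeniusV R))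
    (z : G.States R y) :
    G.splitMap R a y x z = (gen R x (G.pt a 0) + gen R x (G.pt a 2)) * push R y x z := by
  suffices h : G.splitMap R a y x =
      (LinearMap.mulLeft R (gen R x (G.pt a 0) + gen R x (G.pt a 2))) ∘ₗ (push R y x).toLinearMap from
    LinearMap.congr_fun h z
  ext v
  simp only [splitMap, LinearMap.compMultilinearMap_apply, PiTensorProduct.lift.tprod,
    MultilinearMap.compLinearMap_apply, MultilinearMap.mkPiAlgebra_apply, LinearMap.comp_apply,
    AlgHom.toLinearMap_apply, push_tprod, LinearMap.mulLeft_apply]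
  rw [← Finset.mul_prod_erase _ _ (Finset.mem_univ (G.circleOf y (G.pt a 0))),
    ← Finset.mul_prod_erase _ (fun c => G.single R (G.transport y x c) (v c))
      (Finset.mem_univ (G.circleOf y (G.pt a 0))), ← mul_assoc]
  congr 1
  · rw [if_pos rfl]
    simp only [LinearMap.comp_apply, AlgHom.toLinearMap_apply, FrobeniusV.comul_apply, map_mul,
      map_add, place, Algebra.TensorProduct.lift_tmul, map_one, one_mul, mul_one]
    generalize v (G.circleOf y (G.pt a 0)) = w
    rw [FrobeniusV.eq_add w]
    simp only [map_add, map_smul, map_one, mul_add, mul_smul_comm]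
    rw [← ht]
    simp only [gen]
    ring_nf
  · refine Finset.prod_congr rfl fun c hc => ?_
    rw [if_neg (Finset.ne_of_mem_erase hc)]
    rfl

variable (R) in
/-- Polynomials in the points act on the states of every resolution. -/
noncomputable def act (x : Finset G.Crossing) : MvPolynomial G.Point R →ₐ[R] G.States R x :=
  MvPolynomial.aeval (gen R x)

theorem act_surjective (x : Finset G.Crossing) : Function.Surjective (act R x) := by
  rw [← AlgHom.range_eq_top, eq_top_iff]
  intro z _
  have hz : z ∈ Submodule.span R (Set.range (PiTensorProduct.tprod R)) :=
    (PiTensorProduct.span_tprod_eq_top (R := R) (s := fun _ : G.Circle x => FrobeniusV R)) ▸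
      Submodule.mem_top
  have hs : ∀ (c : G.Circle x) (w : FrobeniusV R), G.single R c w ∈ (act R x).range := by
    intro c w
    obtain ⟨p, rfl⟩ : ∃ p, G.circleOf x p = c := ⟨c.out, Quotient.out_eq c⟩
    rw [FrobeniusV.eq_add w, map_add, map_smul, map_smul, map_one]
    refine add_mem (Subalgebra.smul_mem _ (one_mem _) _) (Subalgebra.smul_mem _ ?_ _)
    exact ⟨MvPolynomial.X p, by simp [act, gen]⟩
  induction hz using Submodule.span_induction with
  | mem z hz =>
    obtain ⟨v, rfl⟩ := hz
    have : PiTensorProduct.tprod R v = ∏ c, G.single R c (v c) := by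
      conv_lhs => rw [← Finset.univ_prod_mulSingle v]
      rw [PiTensorProduct.tprod_prod]
      refine Finset.prod_congr rfl fun c _ => ?_
      rw [single, PiTensorProduct.singleAlgHom_apply, MonoidHom.mulSingle_apply]
    rw [this]
    exact prod_mem fun c _ => hs c _
  | zero => exact zero_mem _
  | add _ _ _ _ h1 h2 => exact add_mem (h1 trivial) (h2 trivial)
  | smul n _ _ h => exact Subalgebra.smul_mem _ (h trivial) n

variable (R) in
open Classical in
/-- The factor by which an edge map multiplies. -/
noncomputable def factor (a : G.Crossing) (y : Finset G.Crossing) : MvPolynomial G.Point R :=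
  if G.circleSetoid y (G.pt a 0) (G.pt a 2) then
    MvPolynomial.X (G.pt a 0) + MvPolynomial.X (G.pt a 2) else 1

theorem factor_congr {a : G.Crossing} {x y : Finset G.Crossing}
    (h : G.circleSetoid x (G.pt a 0) (G.pt a 2) ↔ G.circleSetoid y (G.pt a 0) (G.pt a 2)) :
    factor R a x = factor R a y := by
  unfold factor
  by_cases hx : G.circleSetoid x (G.pt a 0) (G.pt a 2)
  · rw [if_pos hx, if_pos (h.1 hx)]
  · rw [if_neg hx, if_neg (fun hy => hx (h.2 hy))]

theorem act_X (x : Finset G.Crossing) (p : G.Point) : act R x (MvPolynomial.X p) = gen R x p := by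
  simp [act]

end CrossingGraph

namespace LinkDiagram

open CrossingGraph

variable {R : Type} [CommRing R] {D : LinkDiagram}

theorem act_factor_mul_gen (R : Type) [CommRing R] {a : D.Crossing} {x y : Finset D.Crossing} (hxy : DifferAt a y x)
    {p q : D.Point} (hpq : D.circleSetoid y p q) :
    act R x (factor R a y) * gen R x p = act R x (factor R a y) * gen R x q := by
  by_cases h : D.circleSetoid y (D.pt a 0) (D.pt a 2)
  · rw [factor, if_pos h, map_add, act_X, act_X]
    have hx := (rel_iff_not_rel hxy).1 h
    have key : ∀ p, (D.circleSetoid x p (D.pt a 0) ∨ D.circleSetoid x p (D.pt a 2)) →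
        (gen R x (D.pt a 0) + gen R x (D.pt a 2)) * gen R x p =
          gen R x (D.pt a 0) * gen R x (D.pt a 2) := by
      rintro p (hp | hp)
      · rw [gen_congr hp, add_mul, gen_mul_self]; ring
      · rw [gen_congr hp, add_mul, gen_mul_self]; ring
    rcases (rel_of_not_rel hxy.symm hx p q).1 hpq with h' | ⟨h1, h2⟩
    · rw [gen_congr h']
    · rw [key p h1, key q h2]
  · rw [gen_congr ((rel_of_not_rel hxy h p q).2 (.inl hpq))]

theorem edgeMap_eq_push {a : D.Crossing} {x y : Finset D.Crossing} (hxy : DifferAt a y x)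
    (z : D.States R y) : D.edgeMap R a y x z = act R x (factor R a y) * push R y x z := by
  by_cases h : D.circleSetoid y (D.pt a 0) (D.pt a 2)
  · have h1 := act_factor_mul_gen R hxy
      (Setoid.symm' _ (Quotient.exact (Quotient.out_eq (D.circleOf y (D.pt a 0)))))
    rw [factor, if_pos h, map_add, act_X, act_X] at h1
    rw [edgeMap, if_pos (circleOf_eq_iff.2 h), splitMap_apply a y x h1, factor, if_pos h, map_add,
      act_X, act_X]
  · rw [edgeMap, if_neg (fun h' => h (circleOf_eq_iff.1 h')), mergeMap_apply, factor, if_neg h,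
      map_one, one_mul]

theorem edgeMap_act {a : D.Crossing} {x y : Finset D.Crossing} (hxy : DifferAt a y x)
    (r : MvPolynomial D.Point R) : D.edgeMap R a y x (act R y r) = act R x (factor R a y * r) := by
  rw [edgeMap_eq_push hxy, map_mul]
  induction r using MvPolynomial.induction_on with
  | C n => simp
  | add r s hr hs => rw [map_add, map_add, map_add, mul_add, hr, hs, mul_add]
  | mul_X r p hr =>
    rw [map_mul, map_mul, act_X, push_gen, ← mul_assoc, hr, map_mul, act_X, mul_right_comm,
      act_factor_mul_gen R hxy (Quotient.exact (Quotient.out_eq (D.circleOf y p)))]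
    ring

/-- The statement that the products of the factors agree, when the role of `a` changes. -/
theorem act_factor_comm_aux (R : Type) [CommRing R] {a b : D.Crossing} {w wa wb x : Finset D.Crossing}
    (h1 : DifferAt a w wa) (h2 : DifferAt b wa x) (h3 : DifferAt b w wb) (h4 : DifferAt a wb x)
    (hne : ¬ (D.circleSetoid w (D.pt a 0) (D.pt a 2) ↔
      D.circleSetoid wb (D.pt a 0) (D.pt a 2))) :
    act R x (factor R b wa * factor R a w) = act R x (factor R a wb * factor R b w) := by
  have e1 := rel_iff_not_rel h1
  have e2 := rel_iff_not_rel h2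
  have e3 := rel_iff_not_rel h3
  have e4 := rel_iff_not_rel h4
  have f1 := rel_of_not_rel h1
  have f3 := rel_of_not_rel h3
  have f4 := rel_of_not_rel h4
  have g3 := rel_of_not_rel h3.symm
  have g4 := rel_of_not_rel h4.symm
  have sx := fun p q => (D.circleSetoid x).symm' (x := p) (y := q)
  have tx := fun p q r => (D.circleSetoid x).trans' (x := p) (y := q) (z := r)
  have sw := fun p q => (D.circleSetoid w).symm' (x := p) (y := q)
  have tw := fun p q r => (D.circleSetoid w).trans' (x := p) (y := q) (z := r)
  have sa := fun p q => (D.circleSetoid wa).symm' (x := p) (y := q)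
  have ta := fun p q r => (D.circleSetoid wa).trans' (x := p) (y := q) (z := r)
  have sb := fun p q => (D.circleSetoid wb).symm' (x := p) (y := q)
  have tb := fun p q r => (D.circleSetoid wb).trans' (x := p) (y := q) (z := r)
  by_cases P1 : D.circleSetoid w (D.pt a 0) (D.pt a 2)
  · have Q2 : ¬ D.circleSetoid wb (D.pt a 0) (D.pt a 2) :=
      fun h => hne ⟨fun _ => h, fun _ => P1⟩
    have X1 : D.circleSetoid x (D.pt a 0) (D.pt a 2) := by
      by_contra h; exact Q2 (e4.2 h)
    have Q1 : D.circleSetoid w (D.pt b 0) (D.pt b 2) := by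
      by_contra Q1
      exact Q2 ((f3 Q1 _ _).2 (.inl P1))
    have B3 := e3.1 Q1
    have hA := ((g3 B3 _ _).1 P1).resolve_left Q2
    have P2 : ¬ D.circleSetoid wa (D.pt b 0) (D.pt b 2) := by
      intro P2
      have X2 := e2.1 P2
      have lift := fun p q h => (f4 Q2 p q).2 (.inl h)
      rcases hA with ⟨hA | hA, hB | hB⟩
      · exact Q2 (tb _ _ _ hA (sb _ _ hB))
      · exact X2 (tx _ _ _ (sx _ _ (lift _ _ hA)) (tx _ _ _ X1 (lift _ _ hB)))
      · exact X2 (tx _ _ _ (sx _ _ (lift _ _ hB)) (tx _ _ _ (sx _ _ X1) (lift _ _ hA)))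
      · exact Q2 (tb _ _ _ hA (sb _ _ hB))
    have X2 : D.circleSetoid x (D.pt b 0) (D.pt b 2) := by
      by_contra h; exact P2 (e2.2 h)
    have hab : D.circleSetoid x (D.pt a 0) (D.pt b 0) := by
      rcases hA.1 with h | h
      · exact (f4 Q2 _ _).2 (.inl h)
      · exact tx _ _ _ ((f4 Q2 _ _).2 (.inl h)) (sx _ _ X2)
    rw [factor, if_neg P2, factor, if_pos P1, factor, if_neg Q2, factor, if_pos Q1]
    simp only [one_mul, map_add, act_X]
    rw [← gen_congr X1, ← gen_congr X2, gen_congr hab]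
  · have Q2 : D.circleSetoid wb (D.pt a 0) (D.pt a 2) := by
      by_contra h; exact hne ⟨fun h' => absurd h' P1, fun h' => absurd h' h⟩
    have X1 := e4.1 Q2
    have Q1 : ¬ D.circleSetoid w (D.pt b 0) (D.pt b 2) := by
      intro Q1
      exact P1 ((g3 (e3.1 Q1) _ _).2 (.inl Q2))
    have hA := ((f3 Q1 _ _).1 Q2).resolve_left P1
    have A2 : D.circleSetoid wa (D.pt a 0) (D.pt a 2) := by
      by_contra h; exact P1 (e1.2 h)
    have lift := fun p q h => (f1 P1 p q).2 (.inl h)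
    have P2 : D.circleSetoid wa (D.pt b 0) (D.pt b 2) := by
      rcases hA with ⟨hA | hA, hB | hB⟩
      · exact (P1 (tw _ _ _ hA (sw _ _ hB))).elim
      · exact ta _ _ _ (sa _ _ (lift _ _ hA)) (ta _ _ _ A2 (lift _ _ hB))
      · exact ta _ _ _ (sa _ _ (lift _ _ hB)) (ta _ _ _ (sa _ _ A2) (lift _ _ hA))
      · exact (P1 (tw _ _ _ hA (sw _ _ hB))).elim
    have X2 := e2.1 P2
    have B1 : D.circleSetoid wb (D.pt b 0) (D.pt b 2) := by
      by_contra h; exact Q1 (e3.2 h)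
    have up := fun p q h => (f3 Q1 p q).2 (.inl h)
    have c0 : ∀ p, D.circleSetoid wb p (D.pt a 0) →
        D.circleSetoid x p (D.pt a 0) ∨ D.circleSetoid x p (D.pt a 2) := by
      intro p hp
      rcases (g4 X1 _ _).1 hp with h | h
      · exact .inl h
      · exact h.1
    have hb0 : D.circleSetoid wb (D.pt b 0) (D.pt a 0) := by
      rcases hA.1 with h | h
      · exact sb _ _ (up _ _ h)
      · exact tb _ _ _ B1 (sb _ _ (up _ _ h))
    have hb2 : D.circleSetoid wb (D.pt b 2) (D.pt a 0) := tb _ _ _ (sb _ _ B1) hb0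
    rw [factor, if_pos P2, factor, if_neg P1, factor, if_pos Q2, factor, if_neg Q1]
    simp only [mul_one, map_add, act_X]
    rcases c0 _ hb0 with h | h <;> rcases c0 _ hb2 with h' | h'
    · exact (X2 (tx _ _ _ h (sx _ _ h'))).elim
    · rw [gen_congr h, gen_congr h']
    · rw [gen_congr h, gen_congr h', add_comm]
    · exact (X2 (tx _ _ _ h (sx _ _ h'))).elim

theorem act_factor_comm (R : Type) [CommRing R] {a b : D.Crossing} {w wa wb x : Finset D.Crossing}
    (h1 : DifferAt a w wa) (h2 : DifferAt b wa x) (h3 : DifferAt b w wb)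
    (h4 : DifferAt a wb x) :
    act R x (factor R b wa * factor R a w) = act R x (factor R a wb * factor R b w) := by
  by_cases ha : D.circleSetoid w (D.pt a 0) (D.pt a 2) ↔
      D.circleSetoid wb (D.pt a 0) (D.pt a 2)
  · by_cases hb : D.circleSetoid w (D.pt b 0) (D.pt b 2) ↔
        D.circleSetoid wa (D.pt b 0) (D.pt b 2)
    · have e1 : factor R a wb = factor R a w := factor_congr ha.symm
      have e2 : factor R b wa = factor R b w := factor_congr hb.symm
      rw [e1, e2, mul_comm]
    · exact (act_factor_comm_aux R h3 h4 h1 h2 hb).symm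
  · exact act_factor_comm_aux R h1 h2 h3 h4 ha

/-- The square faces of the cube commute. -/
theorem edgeMap_comm {a b : D.Crossing} {w wa wb x : Finset D.Crossing}
    (h1 : DifferAt a w wa) (h2 : DifferAt b wa x) (h3 : DifferAt b w wb)
    (h4 : DifferAt a wb x) :
    D.edgeMap R b wa x ∘ₗ D.edgeMap R a w wa = D.edgeMap R a wb x ∘ₗ D.edgeMap R b w wb := by
  refine LinearMap.ext fun z => ?_
  obtain ⟨r, rfl⟩ := act_surjective w z
  simp only [LinearMap.comp_apply]
  rw [edgeMap_act h1, edgeMap_act h2, edgeMap_act h3, edgeMap_act h4, ← mul_assoc, ← mul_assoc,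
    map_mul, act_factor_comm R h1 h2 h3 h4, ← map_mul]

end LinkDiagram

/-! ### The Boolean lattice and its modification -/

open CategoryTheory Opposite

/-- The Boolean lattice on `A`: subsets of `A`, ordered by reverse inclusion. -/
abbrev BooleanLattice (A : Type) : Type := (Finset A)ᵒᵈ

/-- The Boolean lattice on `A` with an additional maximal element `one'` adjoined, which lies above
every element except the maximal element `∅` of the Boolean lattice. -/
inductive ModifiedLattice (A : Type) : Type
  | of (x : Finset A)
  | one'

namespace ModifiedLattice

variable {A : Type}

/-- The order relation `X ≤ Y`. -/
protected def le : ModifiedLattice A → ModifiedLattice A → Prop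
  | of x, of y => y ⊆ x
  | of x, one' => x ≠ ∅
  | one', of _ => False
  | one', one' => True

instance : PartialOrder (ModifiedLattice A) where
  le := ModifiedLattice.le
  le_refl X := by
    cases X with
    | of x => exact Finset.Subset.refl x
    | one' => trivial
  le_trans X Y Z h1 h2 := by
    cases X <;> cases Y <;> cases Z
    · exact Finset.Subset.trans h2 h1
    · exact fun h => h2 (Finset.subset_empty.1 (h ▸ h1))
    · exact h2.elim
    · exact h1
    · exact h1.elim
    · exact h1.elim
    · exact h2
    · trivial
  le_antisymm X Y h1 h2 := by
    cases X <;> cases Y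
    · exact congrArg of (Finset.Subset.antisymm h2 h1)
    · exact h2.elim
    · exact h1.elim
    · rfl

end ModifiedLattice

/-! ### Presheaves on the Boolean lattice from commuting cubes -/

namespace BooleanLattice

variable {A : Type} [DecidableEq A] {𝒞 : Type 1} [Category.{0} 𝒞] (obj : Finset A → 𝒞)
  (edge : ∀ (_ : A) (y x : Finset A), obj y ⟶ obj x)

/-- `f` is the composite of the maps `edge` along an ascending path from `y` to `x` in the cube. -/
inductive IsComposite (y : Finset A) : ∀ x : Finset A, (obj y ⟶ obj x) → Prop
  | refl : IsComposite y y (𝟙 _)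
  | step (x : Finset A) (a : A) (f : obj y ⟶ obj x) (ha : a ∉ x) (hf : IsComposite y x f) :
      IsComposite y (insert a x) (f ≫ edge a x (insert a x))

variable {obj edge}

theorem IsComposite.subset {y x : Finset A} {f : obj y ⟶ obj x} (h : IsComposite obj edge y x f) :
    y ⊆ x := by
  induction h with
  | refl => exact Finset.Subset.refl _
  | step x a f ha hf ih => exact ih.trans (Finset.subset_insert a x)

theorem IsComposite.trans {z y x : Finset A} {f : obj z ⟶ obj y} {g : obj y ⟶ obj x}
    (hf : IsComposite obj edge z y f) (hg : IsComposite obj edge y x g) :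
    IsComposite obj edge z x (f ≫ g) := by
  induction hg with
  | refl => simpa using hf
  | step x a g ha hg ih => simpa using IsComposite.step x a (f ≫ g) ha ih

theorem exists_isComposite {y x : Finset A} (h : y ⊆ x) : ∃ f, IsComposite obj edge y x f := by
  have key : ∀ u : Finset A, Disjoint u y → ∃ f, IsComposite obj edge y (u ∪ y) f := by
    intro u
    induction u using Finset.induction_on with
    | empty => intro _; rw [Finset.empty_union]; exact ⟨_, .refl⟩
    | insert a u ha ih =>
      intro hu
      rw [Finset.disjoint_insert_left] at hu
      obtain ⟨f, hf⟩ := ih hu.2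
      rw [Finset.insert_union]
      exact ⟨_, .step _ a f (by simp [ha, hu.1]) hf⟩
  have := key (x \ y) Finset.sdiff_disjoint
  rwa [Finset.sdiff_union_of_subset h] at this

variable (obj edge) in
/-- The square faces of the cube commute. -/
def Commutes : Prop :=
  ∀ (w : Finset A) (a b : A), a ∉ w → b ∉ w → a ≠ b → ∀ x, x = insert b (insert a w) →
    edge a w (insert a w) ≫ edge b (insert a w) x = edge b w (insert b w) ≫ edge a (insert b w) x

theorem IsComposite.exists_step {y x : Finset A} {f : obj y ⟶ obj x}
    (h : IsComposite obj edge y x f) :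
    (∃ e : y = x, f = eqToHom (congrArg obj e)) ∨
      ∃ (w : Finset A) (a : A) (g : obj y ⟶ obj w), a ∉ w ∧ IsComposite obj edge y w g ∧
        x = insert a w ∧ f = g ≫ edge a w x := by
  cases h with
  | refl => exact .inl ⟨rfl, rfl⟩
  | step w a g ha hg => exact .inr ⟨w, a, g, ha, hg, rfl, rfl⟩

theorem IsComposite.unique (hc : Commutes obj edge) : ∀ (n : ℕ) {y x : Finset A},
    x.card = n → ∀ {f g : obj y ⟶ obj x}, IsComposite obj edge y x f →
      IsComposite obj edge y x g → f = g := by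
  intro n
  induction n using Nat.strong_induction_on with
  | _ n ih =>
    intro y x hn f g hf hg
    have hlt : ∀ (w : Finset A) (a : A), a ∉ w → x = insert a w → w.card < n := by
      intro w a ha e
      rw [← hn, e, Finset.card_insert_of_notMem ha]; omega
    have hnot : ∀ (w : Finset A) (a : A), a ∉ w → x = insert a w → y ⊆ w → y ≠ x := by
      rintro w a ha rfl hw rfl
      exact ha (hw (Finset.mem_insert_self a w))
    rcases hf.exists_step with ⟨e, rfl⟩ | ⟨w, a, f', ha, hf', e, rfl⟩
    · rcases hg.exists_step with ⟨_, rfl⟩ | ⟨w, a, g', ha, hg', e', rfl⟩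
      · rfl
      · exact (hnot w a ha e' hg'.subset e).elim
    · rcases hg.exists_step with ⟨e', rfl⟩ | ⟨v, b, g', hb, hg', e', rfl⟩
      · exact (hnot w a ha e hf'.subset e').elim
      · by_cases hab : a = b
        · subst hab
          have : w = v := by
            rw [← Finset.erase_insert ha, ← Finset.erase_insert hb, ← e, ← e']
          subst this
          rw [ih _ (hlt w a ha e) rfl hf' hg']
        · have hbw : b ∈ w := by
            have : b ∈ insert a w := by rw [← e, e']; exact Finset.mem_insert_self b v
            exact (Finset.mem_insert.1 this).resolve_left (Ne.symm hab)
          have hav : a ∈ v := by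
            have : a ∈ insert b v := by rw [← e', e]; exact Finset.mem_insert_self a w
            exact (Finset.mem_insert.1 this).resolve_left hab
          obtain ⟨u, hbu, hu⟩ : ∃ u, b ∉ u ∧ w = insert b u :=
            ⟨w.erase b, Finset.notMem_erase b w, (Finset.insert_erase hbw).symm⟩
          have hau : a ∉ u := fun h => ha (hu ▸ Finset.mem_insert_of_mem h)
          have hv : v = insert a u := by
            rw [← Finset.erase_insert hb, ← e', e, hu, Finset.erase_insert_of_ne hab,
              Finset.erase_insert hbu]
          subst hu hv
          have hyu : y ⊆ u := by
            intro t ht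
            have h1 := Finset.mem_insert.1 (hf'.subset ht)
            have h2 := Finset.mem_insert.1 (hg'.subset ht)
            rcases h1 with rfl | h1
            · exact h2.resolve_left (Ne.symm hab)
            · exact h1
          obtain ⟨k, hk⟩ := exists_isComposite (obj := obj) (edge := edge) hyu
          rw [ih _ (hlt _ a ha e) rfl hf' (.step u b k hbu hk),
            ih _ (hlt _ b hb e') rfl hg' (.step u a k hau hk), Category.assoc, Category.assoc,
            hc u a b hau hbu hab x e']

variable (obj edge) in
/-- The composite of the maps `edge` along some ascending path from `y` to `x`; when the square faces
commute, it does not depend on the path. -/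
noncomputable def composite {y x : Finset A} (h : y ⊆ x) : obj y ⟶ obj x :=
  Classical.choose (exists_isComposite (obj := obj) (edge := edge) h)

theorem isComposite_composite {y x : Finset A} (h : y ⊆ x) :
    IsComposite obj edge y x (composite obj edge h) :=
  Classical.choose_spec (exists_isComposite (obj := obj) (edge := edge) h)

theorem composite_eq (hc : Commutes obj edge) {y x : Finset A} (h : y ⊆ x) {f : obj y ⟶ obj x}
    (hf : IsComposite obj edge y x f) : composite obj edge h = f :=
  IsComposite.unique hc _ rfl (isComposite_composite h) hf

theorem composite_insert (hc : Commutes obj edge) {y : Finset A} {a : A} (ha : a ∉ y) :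
    composite obj edge (Finset.subset_insert a y) = edge a y (insert a y) :=
  composite_eq hc _ (by
    simpa using IsComposite.step (obj := obj) (edge := edge) y a (𝟙 _) ha .refl)

/-- The presheaf on the Boolean lattice with prescribed values on objects and on covering relations,
when all square faces of the cube commute: a relation `x ≤ y` is sent to the common composite along
all paths from `y` to `x`. -/
noncomputable def presheafOfCube (hc : Commutes obj edge) : (BooleanLattice A)ᵒᵖ ⥤ 𝒞 where
  obj X := obj (OrderDual.ofDual X.unop)
  map {X Y} f := composite obj edge
    (show OrderDual.ofDual X.unop ⊆ OrderDual.ofDual Y.unop from leOfHom f.unop)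
  map_id _ := composite_eq hc _ .refl
  map_comp _ _ := composite_eq hc _
    ((isComposite_composite _).trans (isComposite_composite _))

end BooleanLattice

namespace ModifiedLattice

variable {A : Type} (F : (BooleanLattice A)ᵒᵖ ⥤ AddCommGrpCat.{0})

/-- The values of the extension by zero. -/
def extendObj : ModifiedLattice A → AddCommGrpCat.{0}
  | of x => F.obj (op (OrderDual.toDual x))
  | one' => AddCommGrpCat.of PUnit

/-- The maps of the extension by zero. -/
def extendMap : ∀ (X Y : ModifiedLattice A), Y ≤ X → (extendObj F X ⟶ extendObj F Y)
  | of _, of _, h => F.map (Quiver.Hom.op (homOfLE h))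
  | one', of _, _ => 0
  | of _, one', _ => 0
  | one', one', _ => 𝟙 _

/-- The extension of a presheaf on the Boolean lattice by the zero group at `one'`. -/
def extend : (ModifiedLattice A)ᵒᵖ ⥤ AddCommGrpCat.{0} where
  obj X := extendObj F X.unop
  map {X Y} f := extendMap F X.unop Y.unop (leOfHom f.unop)
  map_id X := by
    obtain ⟨X⟩ := X
    cases X
    · exact F.map_id _
    · rfl
  map_comp {X Y Z} f g := by
    have hf : Y.unop ≤ X.unop := leOfHom f.unop
    have hg : Z.unop ≤ Y.unop := leOfHom g.unop
    obtain ⟨X⟩ := X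
    obtain ⟨Y⟩ := Y
    obtain ⟨Z⟩ := Z
    cases X <;> cases Y <;> cases Z
    · exact F.map_comp _ _
    · exact hg.elim
    · exact hf.elim
    · exact hf.elim
    · exact (Limits.zero_comp).symm
    · exact hg.elim
    · exact (Category.id_comp _).symm
    · exact (Category.id_comp _).symm

end ModifiedLattice

/-! ### The cochain complex of a cube -/

/-- A choice of signs `[x, y]` for the edges of the cube (pairs with `x = y ∪ {a}`, `a ∉ y`) such that
every square face has an odd number of minus signs.  The values on other pairs are irrelevant. -/
structure Signage (A : Type) [DecidableEq A] where
  sign : Finset A → Finset A → ℤˣ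
  square : ∀ (z : Finset A) (a b : A), a ∉ z → b ∉ z → a ≠ b →
    sign (insert a (insert b z)) (insert a z) * sign (insert a z) z *
      (sign (insert a (insert b z)) (insert b z) * sign (insert b z) z) = -1

namespace Signage

variable {A : Type} [DecidableEq A]

instance [Fintype A] : Nonempty (Signage A) := by
  let e := Fintype.equivFin A
  let s : Finset A → Finset A → ℤˣ := fun x y =>
    ∏ a ∈ x \ y, (-1) ^ (y.filter fun j => e j < e a).card
  have key : ∀ (y : Finset A) (a : A), a ∉ y →
      s (insert a y) y = (-1) ^ (y.filter fun j => e j < e a).card := by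
    intro y a ha
    have : insert a y \ y = {a} := by
      ext t; by_cases ht : t = a <;> simp_all
    simp only [s, this, Finset.prod_singleton]
  have main : ∀ (z : Finset A) (a b : A), a ∉ z → b ∉ z → e a < e b →
      s (insert a (insert b z)) (insert a z) * s (insert a z) z *
      (s (insert a (insert b z)) (insert b z) * s (insert b z) z) = -1 := by
    intro z a b ha hb hab
    have hne : a ≠ b := fun h => by simp [h] at hab
    rw [Finset.insert_comm a b, key (insert a z) b (by simp [hne.symm, hb]), key z a ha,
      Finset.insert_comm b a, key (insert b z) a (by simp [hne, ha]), key z b hb,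
      Finset.filter_insert, if_pos hab, Finset.filter_insert, if_neg hab.not_gt,
      Finset.card_insert_of_notMem (by simp [ha]), pow_succ]
    generalize (z.filter fun j => e j < e a).card = m
    generalize (z.filter fun j => e j < e b).card = n
    rcases neg_one_pow_eq_or ℤˣ m with h | h <;> rcases neg_one_pow_eq_or ℤˣ n with h' | h' <;>
      simp [h, h']
  refine ⟨⟨s, fun z a b ha hb hab => ?_⟩⟩
  rcases lt_or_gt_of_ne (fun h => hab (e.injective h)) with h | h
  · exact main z a b ha hb h
  · rw [Finset.insert_comm, mul_comm]; exact main z b a hb ha h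

theorem add_eq_zero (s : Signage A) (z : Finset A) (a b : A) (ha : a ∉ z) (hb : b ∉ z)
    (hab : a ≠ b) (x : Finset A) (hx : x = insert a (insert b z)) :
    (s.sign x (insert a z) * s.sign (insert a z) z : ℤ) +
      s.sign x (insert b z) * s.sign (insert b z) z = 0 := by
  subst hx
  have h := s.square z a b ha hb hab
  generalize s.sign (insert a (insert b z)) (insert a z) = p at *
  generalize s.sign (insert a (insert b z)) (insert b z) = q at *
  generalize s.sign (insert a z) z = r at *
  generalize s.sign (insert b z) z = t at *
  rcases Int.units_eq_one_or p with rfl | rfl <;> rcases Int.units_eq_one_or q with rfl | rfl <;>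
  rcases Int.units_eq_one_or r with rfl | rfl <;> rcases Int.units_eq_one_or t with rfl | rfl <;>
    revert h <;> decide

end Signage

namespace BooleanLattice

/-- The `n`-th row of the cube: the subsets with `n` elements. -/
abbrev Row (A : Type) (n : ℕ) : Type := {x : Finset A // x.card = n}

section

variable {A : Type} (F : (BooleanLattice A)ᵒᵖ ⥤ AddCommGrpCat.{0})

/-- The map of `F` from its value at `y` to its value at `x`, for subsets `y ⊆ x`. -/
def toMap {y x : Finset A} (h : y ⊆ x) :
    F.obj (op (OrderDual.toDual y)) →+ F.obj (op (OrderDual.toDual x)) :=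
  (F.map (Quiver.Hom.op (homOfLE (show OrderDual.toDual x ≤ OrderDual.toDual y from h)))).hom

theorem toMap_toMap {z y x : Finset A} (h : z ⊆ y) (h' : y ⊆ x)
    (v : F.obj (op (OrderDual.toDual z))) :
    toMap F h' (toMap F h v) = toMap F (h.trans h') v := by
  unfold toMap
  rw [← ConcreteCategory.comp_apply (F.map _) (F.map _), ← F.map_comp]
  rfl

end

variable {A : Type} [Fintype A] [DecidableEq A] (F : (BooleanLattice A)ᵒᵖ ⥤ AddCommGrpCat.{0})
  (s : Signage A)

/-- The cochain group `⨁_{|x| = n} F(x)` (a finite direct sum, written as a product). -/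
def cochains (n : ℕ) : AddCommGrpCat.{0} :=
  AddCommGrpCat.of (∀ x : Row A n, F.obj (op (OrderDual.toDual x.1)))

/-- The differential: the sum over all covering pairs `x ≺ y` of the signed maps
`[x, y] F(x ≺ y) : F(y) → F(x)`. -/
def diffHom (n : ℕ) : (∀ y : Row A n, F.obj (op (OrderDual.toDual y.1))) →+
    (∀ x : Row A (n + 1), F.obj (op (OrderDual.toDual x.1))) where
  toFun v x := ∑ y : Row A n, if h : y.1 ⊆ x.1 then
    (s.sign x.1 y.1 : ℤ) • toMap F h (v y) else 0
  map_zero' := by ext x; simp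
  map_add' v w := by
    ext x
    simp only [Pi.add_apply, ← Finset.sum_add_distrib]
    refine Finset.sum_congr rfl fun y _ => ?_
    split_ifs <;> simp

theorem diffHom_apply (n : ℕ) (v : ∀ y : Row A n, F.obj (op (OrderDual.toDual y.1)))
    (x : Row A (n + 1)) : diffHom F s n v x = ∑ y : Row A n, if h : y.1 ⊆ x.1 then
      (s.sign x.1 y.1 : ℤ) • toMap F h (v y) else 0 := rfl

theorem diffHom_diffHom (n : ℕ) (v : ∀ y : Row A n, F.obj (op (OrderDual.toDual y.1))) :
    diffHom F s (n + 1) (diffHom F s n v) = 0 := by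
  ext x
  rw [diffHom_apply, Pi.zero_apply]
  have h1 : ∀ y : Row A (n + 1), (if h : y.1 ⊆ x.1 then
      (s.sign x.1 y.1 : ℤ) • toMap F h (diffHom F s n v y) else 0) =
      ∑ z : Row A n, if h : z.1 ⊆ y.1 ∧ y.1 ⊆ x.1 then
        (s.sign x.1 y.1 * s.sign y.1 z.1 : ℤ) • toMap F (h.1.trans h.2) (v z) else 0 := by
    intro y
    by_cases h : y.1 ⊆ x.1
    · rw [dif_pos h, diffHom_apply, map_sum, Finset.smul_sum]
      refine Finset.sum_congr rfl fun z _ => ?_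
      by_cases h' : z.1 ⊆ y.1
      · rw [dif_pos h', dif_pos ⟨h', h⟩, map_zsmul, smul_smul, toMap_toMap]
      · rw [dif_neg h', dif_neg (fun hh => h' hh.1), map_zero, smul_zero]
    · rw [dif_neg h]
      exact (Finset.sum_eq_zero fun z _ => dif_neg fun hh => h hh.2).symm
  rw [Finset.sum_congr rfl fun y _ => h1 y, Finset.sum_comm]
  refine Finset.sum_eq_zero fun z _ => ?_
  by_cases hzx : z.1 ⊆ x.1
  swap
  · exact Finset.sum_eq_zero fun y _ => dif_neg fun hh => hzx (hh.1.trans hh.2)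
  have hcard : (x.1 \ z.1).card = 2 := by
    rw [Finset.card_sdiff_of_subset hzx, x.2, z.2]; omega
  obtain ⟨a, b, hab, he⟩ := Finset.card_eq_two.1 hcard
  have ha : a ∉ z.1 := (Finset.mem_sdiff.1 (he ▸ Finset.mem_insert_self a {b})).2
  have hb : b ∉ z.1 :=
    (Finset.mem_sdiff.1 (he ▸ Finset.mem_insert_of_mem (Finset.mem_singleton_self b))).2
  have hx : x.1 = insert a (insert b z.1) := by
    rw [← Finset.sdiff_union_of_subset hzx, he, Finset.insert_union, Finset.singleton_union]
  let ya : Row A (n + 1) := ⟨insert a z.1, by rw [Finset.card_insert_of_notMem ha, z.2]⟩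
  let yb : Row A (n + 1) := ⟨insert b z.1, by rw [Finset.card_insert_of_notMem hb, z.2]⟩
  have hya : ya ≠ yb := by
    intro h
    have : a ∈ yb.1 := h ▸ Finset.mem_insert_self a z.1
    exact (Finset.mem_insert.1 this).elim hab ha
  have hsub : ∀ y : Row A (n + 1), z.1 ⊆ y.1 → y.1 ⊆ x.1 → y = ya ∨ y = yb := by
    intro y h1 h2
    obtain ⟨c, hc⟩ : ∃ c, y.1 \ z.1 = {c} := Finset.card_eq_one.1 (by
      rw [Finset.card_sdiff_of_subset h1, y.2, z.2]; omega)
    have hy : y.1 = insert c z.1 := by rw [← Finset.sdiff_union_of_subset h1, hc]; rfl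
    have hcx : c ∈ x.1 \ z.1 :=
      Finset.sdiff_subset_sdiff h2 (Finset.Subset.refl _) (hc ▸ Finset.mem_singleton_self c)
    rw [he, Finset.mem_insert, Finset.mem_singleton] at hcx
    rcases hcx with rfl | rfl
    · exact .inl (Subtype.ext hy)
    · exact .inr (Subtype.ext hy)
  have hax : ya.1 ⊆ x.1 := by
    rw [hx]; exact Finset.insert_subset_insert a (Finset.subset_insert b z.1)
  have hbx : yb.1 ⊆ x.1 := by
    rw [hx]; exact Finset.subset_insert a _
  rw [← Finset.sum_subset (Finset.subset_univ {ya, yb}), Finset.sum_pair hya,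
    dif_pos ⟨Finset.subset_insert a z.1, hax⟩, dif_pos ⟨Finset.subset_insert b z.1, hbx⟩,
    ← add_smul, s.add_eq_zero z.1 a b ha hb hab x.1 hx, zero_smul]
  intro y _ hy
  refine dif_neg fun hh => hy ?_
  rcases hsub y hh.1 hh.2 with rfl | rfl
  · exact Finset.mem_insert_self _ _
  · exact Finset.mem_insert_of_mem (Finset.mem_singleton_self _)

/-- The cochain complex of a presheaf on the Boolean lattice. -/
def cubeComplex : CochainComplex AddCommGrpCat.{0} ℕ :=
  CochainComplex.of (cochains F) (fun n => AddCommGrpCat.ofHom (diffHom F s n)) (by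
    intro n
    ext v
    exact diffHom_diffHom F s n v)

end BooleanLattice

/-! ### Khovanov homology -/

namespace LinkDiagram

open CrossingGraph

variable (D : LinkDiagram)

theorem khovanov_commutes : BooleanLattice.Commutes
    (fun x : Finset D.Crossing => AddCommGrpCat.of (D.States ℤ x))
    (fun a y x => AddCommGrpCat.ofHom (D.edgeMap ℤ a y x).toAddMonoidHom) := by
  rintro w a b ha hb hab x rfl
  ext z
  refine LinearMap.congr_fun (edgeMap_comm (R := ℤ) (differAt_insert ha)
    (differAt_insert (by simp [hab.symm, hb])) (differAt_insert hb) ?_) z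
  rw [Finset.insert_comm]
  exact differAt_insert (by simp [hab, ha])

/-- The Khovanov presheaf on the Boolean lattice of the crossings: `x` is sent to
`V^{⊗ k}` for the `k` circles of `D(x)`, covering relations to the maps given by the multiplication or
the comultiplication of `V`. -/
noncomputable def khovanovCube : (BooleanLattice D.Crossing)ᵒᵖ ⥤ AddCommGrpCat.{0} :=
  BooleanLattice.presheafOfCube D.khovanov_commutes

/-- The Khovanov presheaf on the modified Boolean lattice. -/
noncomputable def khovanovPresheaf : (ModifiedLattice D.Crossing)ᵒᵖ ⥤ AddCommGrpCat.{0} :=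
  ModifiedLattice.extend D.khovanovCube

/-- The `i`-th unnormalised Khovanov homology group of a link diagram, computed with a given choice
of signs. -/
noncomputable def unnormalisedKhovanovHomology (s : Signage D.Crossing) (i : ℕ) :
    AddCommGrpCat.{0} :=
  (BooleanLattice.cubeComplex D.khovanovCube s).homology i

end LinkDiagram

/-! ### Cohomology of the classifying space of a category with coefficients in a presheaf -/

namespace NerveCohomology

universe v

variable {C : Type v} [SmallCategory C] (F : Cᵒᵖ ⥤ AddCommGrpCat.{v})

/-- The map on cochains induced by a monotone map `θ : [m] → [n]`: the value of `θ_* c` at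
`x_0 → ⋯ → x_n` is the image of the value of `c` at `x_{θ 0} → ⋯ → x_{θ m}` under
`F(x_0 → x_{θ 0})`. -/
def cosimplicialMap {m n : SimplexCategory} (θ : m ⟶ n) :
    (∀ x : ComposableArrows C m.len, F.obj (op (x.obj 0))) →+
      (∀ x : ComposableArrows C n.len, F.obj (op (x.obj 0))) where
  toFun c x := F.map (x.map (homOfLE (Fin.zero_le (θ.toOrderHom 0)))).op
    (c (x.whiskerLeft θ.toOrderHom.monotone.functor))
  map_zero' := by ext x; exact map_zero _
  map_add' c c' := by ext x; exact map_add _ _ _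

theorem cosimplicialMap_apply {m n : SimplexCategory} (θ : m ⟶ n)
    (c : ∀ x : ComposableArrows C m.len, F.obj (op (x.obj 0))) (x : ComposableArrows C n.len) :
    cosimplicialMap F θ c x = F.map (x.map (homOfLE (Fin.zero_le (θ.toOrderHom 0)))).op
      (c (x.whiskerLeft θ.toOrderHom.monotone.functor)) := rfl

/-- The cosimplicial abelian group of cochains `∏_{x_0 → ⋯ → x_n} F(x_0)` on the nerve of `C`. -/
def cosimplicialCochains : CosimplicialObject AddCommGrpCat.{v} where
  obj n := AddCommGrpCat.of (∀ x : ComposableArrows C n.len, F.obj (op (x.obj 0)))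
  map θ := AddCommGrpCat.ofHom (cosimplicialMap F θ)
  map_id n := by
    ext c x
    change F.map (x.map (𝟙 _)).op (c x) = c x
    rw [x.map_id, op_id, F.map_id]
    rfl
  map_comp {l m n} θ θ' := by
    ext c x
    change cosimplicialMap F (θ ≫ θ') c x = cosimplicialMap F θ' (cosimplicialMap F θ c) x
    have key : ∀ {P Q R : Cᵒᵖ} (f : P ⟶ Q) (g : Q ⟶ R) (h : P ⟶ R) (v : F.obj P), h = f ≫ g →
        F.map h v = F.map g (F.map f v) := by
      rintro P Q R f g _ v rfl
      rw [F.map_comp]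
      rfl
    refine key (x.map (homOfLE (θ'.toOrderHom.monotone (Fin.zero_le (θ.toOrderHom 0))))).op
      (x.map (homOfLE (Fin.zero_le (θ'.toOrderHom 0)))).op _ _ ?_
    rw [← op_comp, ← x.map_comp]
    rfl

/-- The cochain group `C^n(BC, F) = ∏_{x_0 → ⋯ → x_n} F(x_0)`. -/
def cochains (n : ℕ) : AddCommGrpCat.{v} :=
  AddCommGrpCat.of (∀ x : ComposableArrows C n, F.obj (op (x.obj 0)))

/-- The coboundary `(d c)(x_0 → ⋯ → x_{n+1}) = ∑ i, (-1)^i F(x_0 → x_{δ_i 0}) c(δ_i^* x)`, where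
`δ_i : [n] → [n + 1]` omits `i`, so that `δ_i^* x` is `x` with the object `x_i` omitted; the map
`x_0 → x_{δ_i 0}` is `x_0 → x_1` for `i = 0` and the identity of `x_0` for `i > 0`. -/
def diffHom (n : ℕ) : (∀ x : ComposableArrows C n, F.obj (op (x.obj 0))) →+
    (∀ x : ComposableArrows C (n + 1), F.obj (op (x.obj 0))) :=
  ∑ i : Fin (n + 2), (-1 : ℤ) ^ (i : ℕ) • cosimplicialMap F (SimplexCategory.δ i)

theorem diffHom_apply (n : ℕ) (c : ∀ x : ComposableArrows C n, F.obj (op (x.obj 0)))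
    (x : ComposableArrows C (n + 1)) :
    diffHom F n c x = ∑ i : Fin (n + 2), (-1 : ℤ) ^ (i : ℕ) •
      F.map (x.map (homOfLE (Fin.zero_le (i.succAbove 0)))).op
        (c (x.whiskerLeft (Fin.strictMono_succAbove i).monotone.functor)) := by
  rw [diffHom, AddMonoidHom.finsetSum_apply, Finset.sum_apply]
  rfl

theorem ofHom_diffHom (n : ℕ) : AddCommGrpCat.ofHom (diffHom F n) =
    AlgebraicTopology.AlternatingCofaceMapComplex.objD (cosimplicialCochains F) n := by
  have h := map_sum
    (AddCommGrpCat.homAddEquiv (M := cochains F n) (N := cochains F (n + 1))).symm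
    (fun i : Fin (n + 2) => (-1 : ℤ) ^ (i : ℕ) • cosimplicialMap F (SimplexCategory.δ i))
    Finset.univ
  exact h

theorem diffHom_diffHom (n : ℕ) :
    AddCommGrpCat.ofHom (diffHom F n) ≫ AddCommGrpCat.ofHom (diffHom F (n + 1)) = 0 := by
  rw [ofHom_diffHom, ofHom_diffHom]
  exact AlgebraicTopology.AlternatingCofaceMapComplex.d_squared (cosimplicialCochains F) n

/-- The cochain complex `C^*(BC, F)`. -/
def nerveComplex : CochainComplex AddCommGrpCat.{v} ℕ :=
  CochainComplex.of (cochains F) (fun n => AddCommGrpCat.ofHom (diffHom F n)) (diffHom_diffHom F)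

/-- `H^i(BC; F)`: the cohomology of the classifying space of `C` with (local) coefficients in the
presheaf `F`. -/
noncomputable def nerveCohomology (i : ℕ) : AddCommGrpCat.{v} := (nerveComplex F).homology i

end NerveCohomology

/-! Both sides compute $\mathrm{Ext}^i(\mathbb Z,F)$ in the category of presheaves of abelian groups
on $\mathbb B'$, where $\mathbb Z$ is the constant presheaf; they only use different projective
resolutions of $\mathbb Z$. Nothing about links enters: the argument works for every presheaf on a
finite Boolean lattice, extended by zero to $\mathbf 1'$.

For $x$ in a preorder let $\mathbb Z[x]$ be the presheaf that is $\mathbb Z$ on the elements $\le x$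
and $0$ elsewhere. By Yoneda, maps $\mathbb Z[x]\to F$ are elements of $F(x)$, so sums of such
presheaves are projective. A cochain complex that is natural in $F$ and whose groups are products of
values $F(x)$ is therefore $\mathrm{Hom}(P_*,F)$ for a complex $P_*$ of such sums. If $P_*$,
augmented to $\mathbb Z$, is contractible over each $U$, it resolves $\mathbb Z$. Two complexes with
this property are homotopy equivalent, which gives `FreeCochains.nonempty_homology_iso`.

For the nerve, $P_*$ is the bar resolution. Over $U$ it consists of the chains of elements $\ge U$,
and putting $U$ in front of a chain contracts it.

For the cube, $P_n$ is the sum of the $\mathbb Z[x]$ over the elements of rank $n$, where $\mathbf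
1$ and $\mathbf 1'$ both have rank $0$, and a singleton has boundary $\pm(\mathbf 1-\mathbf 1')$.
Over a nonempty $u$ the subsets of $u$ form a Koszul complex, contracted by adding a point of $u$.
Without $\mathbf 1'$ this would resolve the presheaf concentrated at $\mathbf 1$; the second
generator in degree $0$ makes the cokernel there $\mathbb Z$ instead
(`ModifiedLattice.contractionOfMem`). Over $\mathbf 1$ or $\mathbf 1'$ a single generator, of degree
$0$, is left.

Finally $\mathrm{Hom}(\mathbb Z[\mathbf 1'],F)=F(\mathbf 1')=0$ when $F$ is extended by zero, so
$\mathrm{Hom}(P_*,F)$ is the signed cube complex (`ModifiedLattice.cochainComplexExtendIso`). -/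

section FreePresheaf

/-! ### Free presheaves on a preorder and the Yoneda lemma -/

variable {C : Type} [Preorder C]

/-- The basis elements that live over `U` also live over every `V ≤ U`. -/
def restrictIndex {ι : Type} (p : ι → C) {U V : C} (h : V ≤ U) (i : {i : ι // U ≤ p i}) :
    {i : ι // V ≤ p i} := ⟨i.1, h.trans i.2⟩

/-- The direct sum of the free presheaves of abelian groups on the presheaves represented by the
elements `p i` of a preorder. -/
def freePresheaf {ι : Type} (p : ι → C) : Cᵒᵖ ⥤ AddCommGrpCat.{0} where
  obj U := AddCommGrpCat.of (FreeAbelianGroup {i : ι // U.unop ≤ p i})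
  map f := AddCommGrpCat.ofHom (FreeAbelianGroup.map (restrictIndex p (leOfHom f.unop)))
  map_id _ := AddCommGrpCat.hom_ext FreeAbelianGroup.map_id
  map_comp f g := AddCommGrpCat.hom_ext (FreeAbelianGroup.map_comp
    (f := restrictIndex p (leOfHom f.unop)) (g := restrictIndex p (leOfHom g.unop)))

namespace freePresheaf

variable {ι : Type} {p : ι → C}

/-- A basis element of the value of a free presheaf. -/
def basis (U : C) (i : ι) (h : U ≤ p i) : (freePresheaf p).obj (op U) :=
  FreeAbelianGroup.of (⟨i, h⟩ : {i : ι // U ≤ p i})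

theorem map_basis {U V : Cᵒᵖ} (f : U ⟶ V) (i : ι) (h : U.unop ≤ p i) :
    (freePresheaf p).map f (basis U.unop i h) =
      basis V.unop i ((leOfHom f.unop).trans h) :=
  FreeAbelianGroup.map_of_apply _

theorem hom_ext_basis {U : C} {M : Type} [AddCommGroup M] {f g : (freePresheaf p).obj (op U) →+ M}
    (h : ∀ i hi, f (basis U i hi) = g (basis U i hi)) : f = g :=
  FreeAbelianGroup.lift_ext _ _ fun i => h i.1 i.2

/-- The homomorphism with prescribed values on the basis. -/
def desc {U : C} {M : Type} [AddCommGroup M] (f : ∀ i, U ≤ p i → M) :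
    (freePresheaf p).obj (op U) →+ M :=
  FreeAbelianGroup.lift fun i => f i.1 i.2

theorem desc_basis {U : C} {M : Type} [AddCommGroup M] (f : ∀ i, U ≤ p i → M) (i : ι)
    (hi : U ≤ p i) : desc f (basis U i hi) = f i hi :=
  FreeAbelianGroup.lift_apply_of _ _

/-- Parallel morphisms of a preorder are equal, so `h` needs no relation to `f` and `g` beyond its
endpoints. This removes all bookkeeping of morphisms below. -/
theorem map_map_le {F : Cᵒᵖ ⥤ AddCommGrpCat.{0}} {X Y Z : Cᵒᵖ} (f : X ⟶ Y) (g : Y ⟶ Z) (h : X ⟶ Z)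
    (v : F.obj X) : F.map g (F.map f v) = F.map h v := by
  obtain rfl : h = f ≫ g := Subsingleton.elim _ _
  rw [F.map_comp]; rfl

theorem map_self {F : Cᵒᵖ ⥤ AddCommGrpCat.{0}} {X : Cᵒᵖ} (f : X ⟶ X)
    (v : F.obj X) : F.map f v = v := by
  obtain rfl : f = 𝟙 X := Subsingleton.elim _ _
  rw [F.map_id]; rfl

/-- The map out of a free presheaf with prescribed values on the basis. -/
def descHom {F : Cᵒᵖ ⥤ AddCommGrpCat.{0}} (v : ∀ i, F.obj (op (p i))) : freePresheaf p ⟶ F where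
  app U := AddCommGrpCat.ofHom
    (desc (p := p) (U := U.unop) (M := F.obj U) fun i hi => F.map (homOfLE hi).op (v i))
  naturality U V f := by
    apply AddCommGrpCat.hom_ext
    refine hom_ext_basis (U := U.unop) fun i hi => ?_
    have h := map_basis f i hi
    refine (congrArg (desc (p := p) (U := V.unop) (M := F.obj V)
      fun i hi => F.map (homOfLE hi).op (v i)) h).trans ?_
    refine (desc_basis _ i _).trans ?_
    refine Eq.trans ?_ (congrArg (F.map f) (desc_basis (U := U.unop) _ i hi).symm)
    exact (map_map_le (F := F) _ _ _ _).symm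

theorem descHom_app_basis {F : Cᵒᵖ ⥤ AddCommGrpCat.{0}} (v : ∀ i, F.obj (op (p i)))
    (U : C) (i : ι) (hi : U ≤ p i) :
    (descHom v).app (op U) (basis U i hi) = F.map (homOfLE hi).op (v i) :=
  desc_basis (U := U) (fun i hi => F.map (homOfLE hi).op (v i)) i hi

/-- The uniqueness half of Yoneda: each basis element over `U` is the restriction of the basis
element with the same index over `p i`, and naturality carries the equality down. -/
theorem hom_ext {F : Cᵒᵖ ⥤ AddCommGrpCat.{0}} {f g : freePresheaf p ⟶ F}
    (h : ∀ i, f.app (op (p i)) (basis (p i) i le_rfl) = g.app (op (p i)) (basis (p i) i le_rfl)) :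
    f = g := by
  apply NatTrans.ext
  funext U
  apply AddCommGrpCat.hom_ext
  refine hom_ext_basis (U := U.unop) fun i hi => ?_
  have e := map_basis (p := p) (homOfLE hi).op i le_rfl
  have key : ∀ k : freePresheaf p ⟶ F, k.app U (basis U.unop i hi) =
      F.map (homOfLE hi).op (k.app (op (p i)) (basis (p i) i le_rfl)) := fun k =>
    (congrArg (k.app U) e).symm.trans (NatTrans.naturality_apply k _ _)
  exact (key f).trans ((congrArg _ (h i)).trans (key g).symm)

variable (p) in
/-- Maps out of a free presheaf are families of elements. -/
def homEquiv (F : Cᵒᵖ ⥤ AddCommGrpCat.{0}) :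
    (freePresheaf p ⟶ F) ≃+ ∀ i, F.obj (op (p i)) where
  toFun f i := f.app (op (p i)) (basis (p i) i le_rfl)
  invFun v := descHom v
  left_inv _ := hom_ext fun i => (descHom_app_basis _ _ i _).trans (map_self _ _)
  right_inv _ := funext fun i => (descHom_app_basis _ _ i _).trans (map_self _ _)
  map_add' _ _ := rfl

theorem homEquiv_symm_app_basis {F : Cᵒᵖ ⥤ AddCommGrpCat.{0}} (v : ∀ i, F.obj (op (p i)))
    (U : C) (i : ι) (hi : U ≤ p i) :
    ((homEquiv p F).symm v).app (op U) (basis U i hi) = F.map (homOfLE hi).op (v i) :=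
  descHom_app_basis v U i hi

theorem homEquiv_comp {F G : Cᵒᵖ ⥤ AddCommGrpCat.{0}} (f : freePresheaf p ⟶ F) (g : F ⟶ G) :
    homEquiv p G (f ≫ g) = fun i => g.app _ (homEquiv p F f i) := rfl

/-- Epimorphisms of presheaves are pointwise surjective, and by Yoneda lifting a map amounts to
lifting one element of `X` over each `p i`. -/
instance : Projective (freePresheaf p) where
  factors {E X} f e _ := by
    have he : ∀ U, Function.Surjective (e.app U) := fun U =>
      (AddCommGrpCat.epi_iff_surjective _).1 inferInstance
    choose v hv using fun i => he (op (p i)) (homEquiv p X f i)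
    refine ⟨(homEquiv p E).symm v, (homEquiv p X).injective ?_⟩
    rw [homEquiv_comp, AddEquiv.apply_symm_apply]
    exact funext hv

end freePresheaf

/-! ### Natural cochain complexes and the resolutions that represent them -/

/-- Evaluation commutes with homology, and a presheaf vanishes when all its values do. -/
theorem CategoryTheory.ShortComplex.exact_iff_evaluation {T : Type} [SmallCategory T]
    (S : ShortComplex (T ⥤ AddCommGrpCat.{0})) :
    S.Exact ↔ ∀ t, (S.map ((evaluation T AddCommGrpCat.{0}).obj t)).Exact := by
  simp only [ShortComplex.exact_iff_isZero_homology]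
  rw [Functor.isZero_iff]
  exact forall_congr' fun t =>
    (S.mapHomologyIso ((evaluation T AddCommGrpCat.{0}).obj t)).isZero_iff.symm

/-- A cochain complex depending naturally on a presheaf `F`, whose groups are products of values
of `F`. -/
structure FreeCochains (C : Type) [Preorder C] where
  ι : ℕ → Type
  pos : ∀ n, ι n → C
  diff : ∀ (F : Cᵒᵖ ⥤ AddCommGrpCat.{0}) (n : ℕ), (∀ i : ι n, F.obj (op (pos n i))) →+
    (∀ j : ι (n + 1), F.obj (op (pos (n + 1) j)))
  diff_naturality : ∀ {F G : Cᵒᵖ ⥤ AddCommGrpCat.{0}} (φ : F ⟶ G) (n : ℕ)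
    (v : ∀ i : ι n, F.obj (op (pos n i))),
    diff G n (fun i => φ.app _ (v i)) = fun j => φ.app _ (diff F n v j)
  diff_diff : ∀ (F : Cᵒᵖ ⥤ AddCommGrpCat.{0}) (n : ℕ) (v : ∀ i : ι n, F.obj (op (pos n i))),
    diff F (n + 1) (diff F n v) = 0

namespace FreeCochains

open freePresheaf

variable (K : FreeCochains C)

/-- The cochain complex with coefficients in a presheaf. -/
def cochainComplex (F : Cᵒᵖ ⥤ AddCommGrpCat.{0}) : CochainComplex AddCommGrpCat.{0} ℕ :=
  CochainComplex.of (fun n => AddCommGrpCat.of (∀ i : K.ι n, F.obj (op (K.pos n i))))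
    (fun n => AddCommGrpCat.ofHom (K.diff F n)) (fun n => by
      apply AddCommGrpCat.hom_ext
      apply AddMonoidHom.ext
      exact K.diff_diff F n)

theorem cochainComplex_d (F : Cᵒᵖ ⥤ AddCommGrpCat.{0}) (n : ℕ) :
    (K.cochainComplex F).d n (n + 1) = AddCommGrpCat.ofHom (K.diff F n) :=
  CochainComplex.of_d (fun n => AddCommGrpCat.of (∀ i : K.ι n, F.obj (op (K.pos n i))))
    (fun n => AddCommGrpCat.ofHom (K.diff F n)) n

/-- The differential of the complex of free presheaves that represents the cochains. -/
def chainDiff (n : ℕ) : freePresheaf (K.pos (n + 1)) ⟶ freePresheaf (K.pos n) :=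
  -- The identity of the `n`-th free presheaf corresponds to the universal `n`-cochain; its
  -- coboundary is an element that Yoneda turns back into a map.
  (homEquiv _ _).symm (K.diff _ n (homEquiv _ _ (𝟙 _)))

/-- Every cochain is the image of the universal one under the corresponding map `f`, so naturality
of `diff` in the presheaf gives this. It identifies the complex of maps into `F` with the given
cochains. -/
theorem homEquiv_chainDiff_comp {F : Cᵒᵖ ⥤ AddCommGrpCat.{0}} (n : ℕ)
    (f : freePresheaf (K.pos n) ⟶ F) :
    homEquiv _ _ (K.chainDiff n ≫ f) = K.diff F n (homEquiv _ _ f) := by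
  rw [homEquiv_comp, chainDiff, AddEquiv.apply_symm_apply, ← K.diff_naturality,
    ← homEquiv_comp, Category.id_comp]

theorem chainDiff_comp (n : ℕ) : K.chainDiff (n + 1) ≫ K.chainDiff n = 0 := by
  apply (homEquiv _ _).injective
  rw [homEquiv_chainDiff_comp, chainDiff, AddEquiv.apply_symm_apply, K.diff_diff, map_zero]

/-- The complex of free presheaves that represents the cochains. -/
def chainComplex : ChainComplex (Cᵒᵖ ⥤ AddCommGrpCat.{0}) ℕ :=
  ChainComplex.of (fun n => freePresheaf (K.pos n)) K.chainDiff K.chainDiff_comp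

theorem chainComplex_d (n : ℕ) : K.chainComplex.d (n + 1) n = K.chainDiff n :=
  ChainComplex.of_d (fun n => freePresheaf (K.pos n)) K.chainDiff n

/-- The constant presheaf with value `ℤ`. -/
abbrev constInt (C : Type) [Preorder C] : Cᵒᵖ ⥤ AddCommGrpCat.{0} :=
  (Functor.const _).obj (AddCommGrpCat.of ℤ)

/-- The augmentation, which sends all basis elements to `1`. -/
def augmentation : freePresheaf (K.pos 0) ⟶ constInt C :=
  (homEquiv _ _).symm fun _ => (1 : ℤ)

/-- The pointwise contractibility of the augmented complex of free presheaves. -/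
structure Contraction (K : FreeCochains C) (U : C) where
  start : (freePresheaf (K.pos 0)).obj (op U)
  homotopy : ∀ n, (freePresheaf (K.pos n)).obj (op U) →+ (freePresheaf (K.pos (n + 1))).obj (op U)
  augmentation_start : K.augmentation.app (op U) start = (1 : ℤ)
  -- The degree `-1` part of the homotopy sends `1` to `start`. Basis elements have augmentation
  -- `1`, so on them its contribution is `start` itself, with no coefficient.
  zero : ∀ i (hi : U ≤ K.pos 0 i),
    (K.chainDiff 0).app (op U) (homotopy 0 (basis U i hi)) + start = basis U i hi
  succ : ∀ n i (hi : U ≤ K.pos (n + 1) i),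
    (K.chainDiff (n + 1)).app (op U) (homotopy (n + 1) (basis U i hi)) +
      homotopy n ((K.chainDiff n).app (op U) (basis U i hi)) = basis U i hi

theorem augmentation_basis (U : C) (i : K.ι 0) (hi : U ≤ K.pos 0 i) :
    K.augmentation.app (op U) (basis U i hi) = (1 : ℤ) :=
  homEquiv_symm_app_basis _ _ _ _

theorem Contraction.zero_apply {K : FreeCochains C} {U : C} (c : K.Contraction U)
    (v : (freePresheaf (K.pos 0)).obj (op U)) : (K.chainDiff 0).app (op U) (c.homotopy 0 v) +
      (show ℤ from K.augmentation.app (op U) v) • c.start = v := by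
  let f : (freePresheaf (K.pos 0)).obj (op U) →+ (freePresheaf (K.pos 0)).obj (op U) :=
    ((K.chainDiff 0).app (op U)).hom.comp (c.homotopy 0) +
      (zmultiplesHom _ c.start).comp (K.augmentation.app (op U)).hom
  have : f = AddMonoidHom.id _ := hom_ext_basis fun i hi => by
    change (K.chainDiff 0).app (op U) (c.homotopy 0 (basis U i hi)) +
      (show ℤ from K.augmentation.app (op U) (basis U i hi)) • c.start = _
    rw [augmentation_basis]
    exact (congrArg _ (one_zsmul _)).trans (c.zero i hi)
  exact DFunLike.congr_fun this v

theorem Contraction.succ_apply {K : FreeCochains C} {U : C} (c : K.Contraction U) (n : ℕ)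
    (v : (freePresheaf (K.pos (n + 1))).obj (op U)) :
    (K.chainDiff (n + 1)).app (op U) (c.homotopy (n + 1) v) +
      c.homotopy n ((K.chainDiff n).app (op U) v) = v := by
  let f : (freePresheaf (K.pos (n + 1))).obj (op U) →+ (freePresheaf (K.pos (n + 1))).obj (op U) :=
    ((K.chainDiff (n + 1)).app (op U)).hom.comp (c.homotopy (n + 1)) +
      (c.homotopy n).comp ((K.chainDiff n).app (op U)).hom
  have : f = AddMonoidHom.id _ := hom_ext_basis fun i hi => c.succ n i hi
  exact DFunLike.congr_fun this v

/-- Under Yoneda the augmentation is the constant cochain `1`, and the composite is its coboundary.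
-/
theorem chainDiff_comp_augmentation (h : K.diff (constInt C) 0 (fun _ => (1 : ℤ)) = 0) :
    K.chainDiff 0 ≫ K.augmentation = 0 := by
  apply (homEquiv _ _).injective
  rw [homEquiv_chainDiff_comp, augmentation, AddEquiv.apply_symm_apply, map_zero]
  exact h

theorem exact_succ (c : ∀ U, K.Contraction U) (n : ℕ) :
    (ShortComplex.mk _ _ (K.chainDiff_comp n)).Exact := by
  rw [ShortComplex.exact_iff_evaluation]
  intro U
  rw [ShortComplex.ab_exact_iff]
  intro v hv
  refine ⟨(c U.unop).homotopy (n + 1) v, ?_⟩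
  have h := (c U.unop).succ_apply n v
  have hv' : (K.chainDiff n).app (op U.unop) v = 0 := hv
  rw [hv', map_zero, add_zero] at h
  exact h

theorem exact_zero (c : ∀ U, K.Contraction U) (h : K.chainDiff 0 ≫ K.augmentation = 0) :
    (ShortComplex.mk _ _ h).Exact := by
  rw [ShortComplex.exact_iff_evaluation]
  intro U
  rw [ShortComplex.ab_exact_iff]
  intro v hv
  refine ⟨(c U.unop).homotopy 0 v, ?_⟩
  have h := (c U.unop).zero_apply v
  have hv' : K.augmentation.app (op U.unop) v = (0 : ℤ) := hv
  rw [hv'] at h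
  exact ((congrArg _ (zero_zsmul _)).trans (add_zero _)).symm.trans h

theorem epi_augmentation (c : ∀ U, K.Contraction U) : Epi K.augmentation := by
  rw [NatTrans.epi_iff_epi_app]
  intro U
  rw [AddCommGrpCat.epi_iff_surjective]
  intro (m : ℤ)
  refine ⟨m • (c U.unop).start, (map_zsmul (K.augmentation.app U).hom m _).trans ?_⟩
  exact (congrArg (m • ·) (c U.unop).augmentation_start).trans (mul_one m)

/-- The augmentation as a map of complexes. -/
noncomputable def augmentationMap (h : K.chainDiff 0 ≫ K.augmentation = 0) :
    K.chainComplex ⟶ (ChainComplex.single₀ _).obj (constInt C) :=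
  (ChainComplex.toSingle₀Equiv _ _).symm ⟨K.augmentation,
    (congrArg (· ≫ K.augmentation) (K.chainComplex_d 0)).trans h⟩

theorem augmentationMap_f_zero (h : K.chainDiff 0 ≫ K.augmentation = 0) :
    (K.augmentationMap h).f 0 = K.augmentation :=
  ChainComplex.toSingle₀Equiv_symm_apply_f_zero (C := K.chainComplex) K.augmentation _

/-- The resolution of the constant presheaf. -/
noncomputable def resolution (h : K.diff (constInt C) 0 (fun _ => (1 : ℤ)) = 0)
    (c : ∀ U, K.Contraction U) : ProjectiveResolution (constInt C) where
  complex := K.chainComplex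
  projective n := inferInstanceAs (Projective (freePresheaf (K.pos n)))
  π := K.augmentationMap (K.chainDiff_comp_augmentation h)
  quasiIso := ⟨fun n => by
    cases n with
    | zero =>
      -- In degree 0 a quasi-isomorphism means that the augmentation is a cokernel of the first
      -- differential: exactness at degree 0 together with surjectivity.
      rw [ChainComplex.quasiIsoAt₀_iff, ShortComplex.quasiIso_iff_of_zeros']
      · refine (ShortComplex.exact_and_epi_g_iff_of_iso ?_).2
          ⟨K.exact_zero c (K.chainDiff_comp_augmentation h), K.epi_augmentation c⟩
        exact ShortComplex.isoMk (Iso.refl _) (Iso.refl _) (Iso.refl _)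
          ((Category.id_comp _).trans
            ((Category.comp_id _).trans (K.chainComplex_d 0)).symm)
          ((Category.id_comp _).trans ((Category.comp_id _).trans
            (K.augmentationMap_f_zero (K.chainDiff_comp_augmentation h))).symm)
      all_goals rfl
    | succ n =>
      -- In positive degrees the target has no homology, so exactness of the source is what is
      -- needed.
      rw [quasiIsoAt_iff_exactAt']
      · rw [HomologicalComplex.exactAt_iff' _ (n + 1 + 1) (n + 1) n (by simp) (by simp)]
        refine (ShortComplex.exact_iff_of_iso ?_).2 (K.exact_succ c n)
        exact ShortComplex.isoMk (Iso.refl _) (Iso.refl _) (Iso.refl _)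
          ((Category.id_comp _).trans
            ((Category.comp_id _).trans (K.chainComplex_d (n + 1))).symm)
          ((Category.id_comp _).trans
            ((Category.comp_id _).trans (K.chainComplex_d n)).symm)
      · apply ChainComplex.exactAt_succ_single_obj⟩

/-- The cochains with coefficients in `F` are the maps from the representing complex to `F`. -/
noncomputable def cochainComplexIso (F : Cᵒᵖ ⥤ AddCommGrpCat.{0}) :
    (((preadditiveYoneda.obj F).rightOp.mapHomologicalComplex _).obj K.chainComplex).unop ≅
      K.cochainComplex F :=
  HomologicalComplex.Hom.isoOfComponents
    (fun n => (homEquiv (K.pos n) F).toAddCommGrpIso) (by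
      intro i j hij
      obtain rfl : i + 1 = j := hij
      apply AddCommGrpCat.hom_ext
      apply AddMonoidHom.ext
      intro f
      refine (congrArg (fun k => k.hom (homEquiv (K.pos i) F f)) (K.cochainComplex_d F i)).trans ?_
      refine (K.homEquiv_chainDiff_comp i f).symm.trans ?_
      exact congrArg (fun k => homEquiv _ _ (k ≫ f)) (K.chainComplex_d i).symm)

/-- Both representing complexes are projective resolutions of the same presheaf, hence homotopy
equivalent. The additive functor of maps into `F` preserves homotopy equivalences; since it is
contravariant it is taken with values in the opposite category, and the homology is brought back by
`unop`. -/
theorem nonempty_homology_iso (K L : FreeCochains C)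
    (hK : K.diff (constInt C) 0 (fun _ => (1 : ℤ)) = 0)
    (hL : L.diff (constInt C) 0 (fun _ => (1 : ℤ)) = 0)
    (cK : ∀ U, K.Contraction U) (cL : ∀ U, L.Contraction U)
    (F : Cᵒᵖ ⥤ AddCommGrpCat.{0}) (i : ℕ) :
    Nonempty ((K.cochainComplex F).homology i ≅ (L.cochainComplex F).homology i) := by
  let e := ((preadditiveYoneda.obj F).rightOp.mapHomotopyEquiv
    (ProjectiveResolution.homotopyEquiv (K.resolution hK cK) (L.resolution hL cL))).toHomologyIso i
  have h : ∀ M : FreeCochains C, Nonempty ((M.cochainComplex F).homology i ≅ unop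
      ((((preadditiveYoneda.obj F).rightOp.mapHomologicalComplex _).obj
        M.chainComplex).homology i)) := fun M =>
    ⟨HomologicalComplex.homologyMapIso (M.cochainComplexIso F).symm i ≪≫
      HomologicalComplex.homologyUnop _ i⟩
  exact ⟨(h K).some ≪≫ e.unop.symm ≪≫ (h L).some.symm⟩

end FreeCochains

end FreePresheaf

/-! ### The bar resolution of the nerve -/

namespace NerveCohomology

open freePresheaf FreeCochains

variable {C : Type} [Preorder C]

/-- Chains in a preorder are determined by their objects. -/
theorem composableArrows_ext {n : ℕ} {x y : ComposableArrows C n}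
    (h : ∀ i, x.obj i = y.obj i) : x = y :=
  CategoryTheory.Functor.ext h fun _ _ _ => Subsingleton.elim _ _

variable (C) in
/-- The cochains on the nerve of a preorder. -/
def nerveCochains : FreeCochains C where
  ι n := ComposableArrows C n
  pos _ x := x.obj 0
  diff F n := diffHom F n
  diff_naturality {F G} φ n v := by
    funext x
    rw [diffHom_apply, diffHom_apply]
    refine Eq.trans (Finset.sum_congr rfl fun i _ => ?_)
      (map_sum (φ.app (op (x.obj 0))).hom _ _).symm
    refine Eq.trans ?_ (map_zsmul (φ.app (op (x.obj 0))).hom _ _).symm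
    exact congrArg _ (NatTrans.naturality_apply φ _ _).symm
  diff_diff F n v :=
    congrArg (fun k => k.hom v) (diffHom_diffHom F n)

/-- The basis element of a chain. -/
def chainBasis {n : ℕ} (U : C) (x : ComposableArrows C n) (h : U ≤ x.obj 0) :
    (freePresheaf ((nerveCochains C).pos n)).obj (op U) :=
  basis (p := (nerveCochains C).pos n) U x h

theorem chainBasis_congr {n : ℕ} {U : C} {x y : ComposableArrows C n} (e : x = y)
    (hx : U ≤ x.obj 0) (hy : U ≤ y.obj 0) : chainBasis U x hx = chainBasis U y hy := by
  subst e; rfl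

/-- The bar differential is the alternating sum of faces. Omitting `x_0` replaces the first object
by a larger one, so each face still lies over `U`; the restriction maps of the coboundary only
change the element over which a basis element is read. -/
theorem chainDiff_chainBasis (U : C) (n : ℕ) (x : ComposableArrows C (n + 1)) (hU : U ≤ x.obj 0) :
    ((nerveCochains C).chainDiff n).app (op U) (chainBasis U x hU) =
      ∑ i : Fin (n + 2), (-1 : ℤ) ^ (i : ℕ) • chainBasis U
        (x.whiskerLeft (Fin.strictMono_succAbove i).monotone.functor)
        (hU.trans (leOfHom (x.map (homOfLE (Fin.zero_le (i.succAbove 0)))))) := by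
  refine (homEquiv_symm_app_basis (p := (nerveCochains C).pos (n + 1)) _ U x hU).trans ?_
  refine (congrArg (fun z => (freePresheaf ((nerveCochains C).pos n)).map (homOfLE hU).op z)
    (diffHom_apply _ n _ x)).trans ?_
  refine (map_sum ((freePresheaf ((nerveCochains C).pos n)).map (homOfLE hU).op).hom _ _).trans ?_
  refine Finset.sum_congr rfl fun i _ => ?_
  refine (map_zsmul ((freePresheaf ((nerveCochains C).pos n)).map (homOfLE hU).op).hom _ _).trans ?_
  refine congrArg _ ?_
  refine (congrArg (fun z => (freePresheaf ((nerveCochains C).pos n)).map (homOfLE hU).op z)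
    (map_basis (p := (nerveCochains C).pos n)
      (x.map (homOfLE (Fin.zero_le (i.succAbove 0)))).op _ le_rfl)).trans ?_
  exact map_basis (p := (nerveCochains C).pos n) (homOfLE hU).op _ _

/-- The restriction maps of the constant presheaf are identities, so the two faces of a 1-simplex
contribute `1 - 1`. -/
theorem diff_one : (nerveCochains C).diff (constInt C) 0 (fun _ => (1 : ℤ)) = 0 := by
  funext x
  refine (diffHom_apply (constInt C) 0 (fun _ => (1 : ℤ)) x).trans ?_
  rw [Fin.sum_univ_two]
  exact (by norm_num : (-1 : ℤ) ^ 0 • (1 : ℤ) + (-1 : ℤ) ^ 1 • (1 : ℤ) = 0)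

/-- Putting `U` in front of a chain. -/
def prepend {n : ℕ} {U : C} (x : ComposableArrows C n) (h : U ≤ x.obj 0) :
    ComposableArrows C (n + 1) :=
  ComposableArrows.precomp x (X := U) (homOfLE h)

theorem le_mk₀ (U : C) : U ≤ (ComposableArrows.mk₀ U).obj 0 := le_rfl (a := U)

theorem le_prepend {n : ℕ} {U : C} (x : ComposableArrows C n) (h : U ≤ x.obj 0) :
    U ≤ (prepend x h).obj 0 := le_rfl (a := U)

theorem prepend_obj_succ {n : ℕ} {U : C} (x : ComposableArrows C n) (h : U ≤ x.obj 0)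
    (i : Fin (n + 1)) : (prepend x h).obj i.succ = x.obj i := rfl

theorem whiskerLeft_prepend_zero {n : ℕ} {U : C} (x : ComposableArrows C n) (h : U ≤ x.obj 0) :
    (prepend x h).whiskerLeft (Fin.strictMono_succAbove 0).monotone.functor = x :=
  composableArrows_ext fun _ => rfl

theorem whiskerLeft_prepend_one {U : C} (x : ComposableArrows C 0) (h : U ≤ x.obj 0) :
    (prepend x h).whiskerLeft (Fin.strictMono_succAbove 1).monotone.functor =
      ComposableArrows.mk₀ U :=
  composableArrows_ext fun i => by
    obtain rfl : i = 0 := Fin.fin_one_eq_zero i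
    rfl

theorem whiskerLeft_prepend_succ {n : ℕ} {U : C} (x : ComposableArrows C (n + 1))
    (h : U ≤ x.obj 0) (i : Fin (n + 2))
    (g : U ≤ (x.whiskerLeft (Fin.strictMono_succAbove i).monotone.functor).obj 0) :
    (prepend x h).whiskerLeft (Fin.strictMono_succAbove i.succ).monotone.functor =
      prepend (x.whiskerLeft (Fin.strictMono_succAbove i).monotone.functor) g :=
  composableArrows_ext fun j => by
    induction j using Fin.cases with
    | zero => rfl
    | succ j =>
      change (prepend x h).obj (i.succ.succAbove j.succ) = x.obj (i.succAbove j)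
      rw [Fin.succ_succAbove_succ, prepend_obj_succ]

/-- The homomorphism that puts `U` in front of a chain. -/
def cone (U : C) (n : ℕ) : (freePresheaf ((nerveCochains C).pos n)).obj (op U) →+
    (freePresheaf ((nerveCochains C).pos (n + 1))).obj (op U) :=
  desc (p := (nerveCochains C).pos n) fun (x : ComposableArrows C n) hx =>
    chainBasis U (prepend x hx) (le_prepend x hx)

theorem cone_chainBasis {n : ℕ} (U : C) (x : ComposableArrows C n) (h : U ≤ x.obj 0) :
    cone U n (chainBasis U x h) = chainBasis U (prepend x h) (le_prepend x h) :=
  desc_basis (p := (nerveCochains C).pos n) (fun (x : ComposableArrows C n) hx =>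
    chainBasis U (prepend x hx) (le_prepend x hx)) x h

/-- The edge from `U` to `x` has boundary `x - U`. -/
theorem chainDiff_cone_zero (U : C) (x : ComposableArrows C 0) (h : U ≤ x.obj 0) :
    ((nerveCochains C).chainDiff 0).app (op U) (cone U 0 (chainBasis U x h)) +
      chainBasis U (ComposableArrows.mk₀ U) (le_mk₀ U) = chainBasis U x h := by
  rw [cone_chainBasis, chainDiff_chainBasis, Fin.sum_univ_two,
    chainBasis_congr (whiskerLeft_prepend_zero x h) _ h,
    chainBasis_congr (whiskerLeft_prepend_one x h) _ (le_mk₀ U)]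
  simp

/-- Face `0` of the cone is the chain itself. Face `i + 1` of the cone is the cone over face `i`,
and the shift of the index reverses its sign, so it cancels against the second summand. -/
theorem chainDiff_cone_succ (U : C) (n : ℕ) (x : ComposableArrows C (n + 1)) (h : U ≤ x.obj 0) :
    ((nerveCochains C).chainDiff (n + 1)).app (op U) (cone U (n + 1) (chainBasis U x h)) +
      cone U n (((nerveCochains C).chainDiff n).app (op U) (chainBasis U x h)) =
        chainBasis U x h := by
  rw [cone_chainBasis, chainDiff_chainBasis, chainDiff_chainBasis, Fin.sum_univ_succ,
    chainBasis_congr (whiskerLeft_prepend_zero x h) _ h, map_sum, add_assoc,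
    ← Finset.sum_add_distrib, Finset.sum_eq_zero]
  · simp
  intro i _
  rw [map_zsmul, cone_chainBasis,
    chainBasis_congr (whiskerLeft_prepend_succ x h i
      (h.trans (leOfHom (x.map (homOfLE (Fin.zero_le (i.succAbove 0))))))) _
      (le_prepend _ _), ← add_smul, Fin.val_succ, pow_succ]
  simp

/-- The augmented bar resolution is contractible. -/
def contraction (U : C) : (nerveCochains C).Contraction U where
  start := chainBasis U (ComposableArrows.mk₀ U) (le_mk₀ U)
  homotopy := cone U
  augmentation_start := augmentation_basis _ _ _ _
  zero := chainDiff_cone_zero U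
  succ := chainDiff_cone_succ U

end NerveCohomology

/-! ### The signed cube with two maximal elements -/

namespace ModifiedLattice

open freePresheaf FreeCochains

variable {A : Type}

/-- The underlying subset; the additional maximal element is given the empty set. -/
def carrier : ModifiedLattice A → Finset A
  | of x => x
  | one' => ∅

variable (A) in
/-- The elements of a given rank. -/
abbrev Level (n : ℕ) : Type := {X : ModifiedLattice A // X.carrier.card = n}

/-- The elements are the subsets and one additional element. -/
def equivOption : ModifiedLattice A ≃ Option (Finset A) where
  toFun
    | of x => some x
    | one' => none
  invFun
    | some x => of x
    | none => one'
  left_inv X := by cases X <;> rfl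
  right_inv X := by cases X <;> rfl

theorem of_le_of {x y : Finset A} : of x ≤ of y ↔ y ⊆ x := Iff.rfl

theorem of_le_one' {x : Finset A} : of x ≤ one' ↔ x ≠ ∅ := Iff.rfl

theorem one'_le_iff {X : ModifiedLattice A} : one' ≤ X ↔ X = one' := by
  cases X
  · exact ⟨fun h => h.elim, fun h => by cases h⟩
  · exact ⟨fun _ => rfl, fun _ => le_rfl⟩

theorem of_empty_le_iff {X : ModifiedLattice A} : of ∅ ≤ X ↔ X = of ∅ := by
  cases X with
  | of x => rw [of_le_of, Finset.subset_empty]; exact ⟨fun h => h ▸ rfl, fun h => by cases h; rfl⟩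
  | one' => exact ⟨fun h => (h rfl).elim, fun h => by cases h⟩

/-- The additional element has rank `0`, so it can only occur in the lowest level; all higher levels
are rows of the Boolean lattice. -/
theorem eq_of_of_card {X : ModifiedLattice A} {n : ℕ} (h : X.carrier.card = n + 1) :
    X = of X.carrier := by
  cases X with
  | of x => rfl
  | one' => cases h

instance [Fintype A] : Fintype (ModifiedLattice A) := Fintype.ofEquiv _ equivOption.symm

/-- The sign that distinguishes the two maximal elements. -/
def maxSign : ModifiedLattice A → ℤ
  | of _ => 1
  | one' => -1

variable [DecidableEq A] (s : Signage A)

open Classical in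
/-- The incidence numbers of the cube with two maximal elements. -/
noncomputable def coef (X Y : ModifiedLattice A) : ℤ :=
  -- Only consecutive ranks matter below. The factor `maxSign` gives the two maximal elements
  -- opposite coefficients in the boundary of a singleton, so that the augmentation kills that
  -- boundary.
  if X ≤ Y then s.sign X.carrier Y.carrier * Y.maxSign else 0

theorem coef_of {x y : Finset A} (h : y ⊆ x) : coef s (of x) (of y) = s.sign x y := by
  rw [coef, if_pos (of_le_of.2 h)]
  exact mul_one _

theorem coef_one' {x : Finset A} (h : x ≠ ∅) : coef s (of x) one' = -s.sign x ∅ := by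
  rw [coef, if_pos (of_le_one'.2 h)]
  exact mul_neg_one _

theorem coef_eq_zero {X Y : ModifiedLattice A} (h : ¬ X ≤ Y) : coef s X Y = 0 := if_neg h

theorem sign_mul_self (x y : Finset A) : (s.sign x y : ℤ) * s.sign x y = 1 := by
  rw [← Units.val_mul, Int.units_mul_self, Units.val_one]

/-- The four edges of a square have sign product `-1`, so however they are paired the two products
are opposite. Here the pairs are not the two paths: each consists of the opposite face or
point-adding steps that occur together in the homotopy identity. -/
theorem sign_square {z : Finset A} {a b : A} (ha : a ∉ z) (hb : b ∈ z) :
    (s.sign (insert a z) z : ℤ) * s.sign (insert a z) (insert a (z.erase b)) +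
      s.sign z (z.erase b) * s.sign (insert a (z.erase b)) (z.erase b) = 0 := by
  have hab : a ≠ b := by rintro rfl; exact ha hb
  have h := s.square (z.erase b) a b (fun h => ha (Finset.mem_of_mem_erase h))
    (Finset.notMem_erase b z) hab
  rw [Finset.insert_erase hb] at h
  generalize s.sign (insert a z) (insert a (z.erase b)) = p at *
  generalize s.sign (insert a z) z = q at *
  generalize s.sign (insert a (z.erase b)) (z.erase b) = r at *
  generalize s.sign z (z.erase b) = t at *
  rcases Int.units_eq_one_or p with rfl | rfl <;> rcases Int.units_eq_one_or q with rfl | rfl <;>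
  rcases Int.units_eq_one_or r with rfl | rfl <;> rcases Int.units_eq_one_or t with rfl | rfl <;>
    revert h <;> decide

variable [Fintype A]

/-- The rank `n` elements above `x` are the sets obtained by deleting one point and, for `n = 0`
only, also `one'`. In that case `x` is a singleton, the deleted set is empty, and `one'` enters with
the opposite of the same sign. -/
theorem sum_coef_smul {M : Type} [AddCommGroup M] (n : ℕ) {x : Finset A} (hx : x.card = n + 1)
    (g : ModifiedLattice A → M) :
    ∑ Y : Level A n, coef s (of x) Y.1 • g Y.1 = ∑ b ∈ x, (s.sign x (x.erase b) : ℤ) •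
      (g (of (x.erase b)) - if n = 0 then g one' else 0) := by
  have hne : x ≠ ∅ := by rintro rfl; cases hx
  have h1 : ∑ Y : Level A n, coef s (of x) Y.1 • g Y.1 =
      ∑ Y : ModifiedLattice A, if Y.carrier.card = n then coef s (of x) Y • g Y else 0 := by
    rw [← Finset.sum_filter]
    exact (Finset.sum_subtype _ (fun Y => by
      rw [Finset.mem_filter, and_iff_right (Finset.mem_univ Y)])
      fun Y => coef s (of x) Y • g Y).symm
  -- Separate the additional element from the subsets.
  rw [h1, ← equivOption.symm.sum_comp, Fintype.sum_option]
  simp only [smul_sub, Finset.sum_sub_distrib]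
  rw [add_comm, sub_eq_add_neg]
  congr 1
  · have himg : ∑ b ∈ x, (s.sign x (x.erase b) : ℤ) • g (of (x.erase b)) =
        ∑ y ∈ x.image x.erase, (s.sign x y : ℤ) • g (of y) :=
      (Finset.sum_image (f := fun y => (s.sign x y : ℤ) • g (of y))
        (fun a ha b hb h => (Finset.erase_inj x ha).1 h)).symm
    -- Subsets of the right size that are not of the form `x.erase b` are not contained in `x`, and
    -- their coefficient is zero.
    rw [himg, ← Finset.sum_subset (Finset.subset_univ (x.image x.erase))]
    · refine Finset.sum_congr rfl fun y hy => ?_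
      obtain ⟨b, hb, rfl⟩ := Finset.mem_image.1 hy
      change (if (x.erase b).card = n then coef s (of x) (of (x.erase b)) • g (of (x.erase b))
        else 0) = _
      rw [if_pos (by rw [Finset.card_erase_of_mem hb, hx]; rfl), coef_of s (Finset.erase_subset b x)]
    · intro y _ hy
      change (if y.card = n then coef s (of x) (of y) • g (of y) else 0) = 0
      split_ifs with h
      · rw [coef_eq_zero, zero_smul]
        intro hle
        apply hy
        obtain ⟨b, hb⟩ : ∃ b, x \ y = {b} := Finset.card_eq_one.1 (by
          rw [Finset.card_sdiff_of_subset (of_le_of.1 hle), hx, h]; omega)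
        have hbx : b ∈ x := (Finset.mem_sdiff.1 (hb ▸ Finset.mem_singleton_self b)).1
        refine Finset.mem_image.2 ⟨b, hbx, ?_⟩
        rw [← Finset.sdiff_singleton_eq_erase, ← hb, Finset.sdiff_sdiff_eq_self (of_le_of.1 hle)]
      · rfl
  · change (if (∅ : Finset A).card = n then coef s (of x) one' • g one' else 0) = _
    rw [Finset.card_empty]
    by_cases hn : n = 0
    · subst hn
      obtain ⟨b, rfl⟩ := Finset.card_eq_one.1 hx
      simp [coef_one']
    · rw [if_neg (Ne.symm hn), if_neg hn]
      simp

/-- This is `d ∘ d = 0` for the cube complex of the constant presheaf `ℤ`, read off at `x` for the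
indicator cochain of `z`. -/
theorem sum_sign_mul_sign (n : ℕ) (x : BooleanLattice.Row A (n + 2)) (z : BooleanLattice.Row A n) :
    ∑ y : BooleanLattice.Row A (n + 1), (if y.1 ⊆ x.1 then (s.sign x.1 y.1 : ℤ) else 0) *
      (if z.1 ⊆ y.1 then (s.sign y.1 z.1 : ℤ) else 0) = 0 := by
  let F : (BooleanLattice A)ᵒᵖ ⥤ AddCommGrpCat.{0} :=
    (Functor.const _).obj (AddCommGrpCat.of ℤ)
  have h := congrFun (BooleanLattice.diffHom_diffHom F s n (Pi.single z (1 : ℤ))) x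
  refine Eq.trans ?_ h
  rw [BooleanLattice.diffHom_apply]
  refine Finset.sum_congr rfl fun y _ => ?_
  have htoMap : ∀ {u v : Finset A} (h : u ⊆ v) (m : ℤ), BooleanLattice.toMap F h m = m :=
    fun _ _ => rfl
  have hy : BooleanLattice.diffHom F s n (Pi.single z (1 : ℤ)) y =
      (if z.1 ⊆ y.1 then (s.sign y.1 z.1 : ℤ) else 0) := by
    rw [BooleanLattice.diffHom_apply, Finset.sum_eq_single z]
    · rw [Pi.single_eq_same]
      split_ifs with h
      · exact (congrArg _ (htoMap h 1)).trans (mul_one (s.sign y.1 z.1 : ℤ))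
      · rfl
    · intro w _ hw
      rw [Pi.single_eq_of_ne hw]
      split_ifs with h
      · rw [map_zero, smul_zero]
      · rfl
    · exact fun h => (h (Finset.mem_univ z)).elim
  rw [hy]
  split_ifs with h1 h2 h2
  · exact (congrArg ((s.sign x.1 y.1 : ℤ) * ·) (htoMap h1 _)).symm
  · refine Eq.symm ((congrArg ((s.sign x.1 y.1 : ℤ) * ·) (htoMap h1 0)).trans ?_)
    exact (mul_zero _).trans (mul_zero _).symm
  · exact zero_mul _
  · exact zero_mul _

/-- The intermediate elements have positive rank, so they are nonempty subsets and lie below both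
maximal elements. The sum is therefore the one for plain signs times `Z.1.maxSign`; for `one'` it is
minus the sum for the empty set. -/
theorem sum_coef_mul_coef (n : ℕ) (X : Level A (n + 2)) (Z : Level A n) :
    ∑ Y : Level A (n + 1), coef s X.1 Y.1 * coef s Y.1 Z.1 = 0 := by
  let e : Level A (n + 1) ≃ BooleanLattice.Row A (n + 1) :=
    { toFun := fun Y => ⟨Y.1.carrier, Y.2⟩
      invFun := fun y => ⟨of y.1, y.2⟩
      left_inv := fun Y => Subtype.ext (eq_of_of_card Y.2).symm
      right_inv := fun _ => rfl }
  have h := congrArg (Z.1.maxSign * ·)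
    (sum_sign_mul_sign s n ⟨X.1.carrier, X.2⟩ ⟨Z.1.carrier, Z.2⟩)
  dsimp only at h
  rw [mul_zero, Finset.mul_sum] at h
  rw [← h, ← e.symm.sum_comp]
  refine Finset.sum_congr rfl fun y _ => ?_
  obtain ⟨X, hX⟩ := X
  obtain ⟨Z, hZ⟩ := Z
  obtain ⟨y, hy⟩ := y
  cases X with
  | one' => cases hX
  | of x =>
    change coef s (of x) (of y) * coef s (of y) Z =
      Z.maxSign * ((if y ⊆ x then (s.sign x y : ℤ) else 0) *
        (if Z.carrier ⊆ y then (s.sign y Z.carrier : ℤ) else 0))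
    by_cases hyx : y ⊆ x
    · rw [coef_of s hyx, if_pos hyx]
      cases Z with
      | of z =>
        by_cases hzy : z ⊆ y
        · rw [coef_of s hzy, if_pos (c := (of z).carrier ⊆ y) hzy]
          exact (one_mul _).symm
        · rw [coef_eq_zero s (mt of_le_of.1 hzy), if_neg (c := (of z).carrier ⊆ y) hzy, mul_zero,
            mul_zero]
      | one' =>
        have hy0 : y ≠ ∅ := by rintro rfl; cases hy
        rw [coef_one' s hy0, if_pos (c := one'.carrier ⊆ y) (Finset.empty_subset y)]
        exact (mul_neg _ _).trans (neg_one_mul _).symm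
    · rw [coef_eq_zero s (mt of_le_of.1 hyx), if_neg hyx, zero_mul, zero_mul, mul_zero]

open Classical in
/-- The differential of the cube with two maximal elements. -/
noncomputable def cubeDiff (F : (ModifiedLattice A)ᵒᵖ ⥤ AddCommGrpCat.{0}) (n : ℕ) :
    (∀ Y : Level A n, F.obj (op Y.1)) →+ (∀ X : Level A (n + 1), F.obj (op X.1)) where
  toFun v X := ∑ Y : Level A n, if h : X.1 ≤ Y.1 then
    coef s X.1 Y.1 • F.map (homOfLE h).op (v Y) else 0
  map_zero' := by
    ext X
    refine Finset.sum_eq_zero fun Y _ => ?_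
    split_ifs
    · exact (congrArg _ (map_zero _)).trans (smul_zero _)
    · rfl
  map_add' v w := by
    ext X
    refine Eq.trans (Finset.sum_congr rfl fun Y _ => ?_) Finset.sum_add_distrib
    split_ifs
    · exact (congrArg _ (map_add _ _ _)).trans (smul_add _ _ _)
    · exact (add_zero _).symm

open Classical in
theorem cubeDiff_apply (F : (ModifiedLattice A)ᵒᵖ ⥤ AddCommGrpCat.{0}) (n : ℕ)
    (v : ∀ Y : Level A n, F.obj (op Y.1)) (X : Level A (n + 1)) :
    cubeDiff s F n v X = ∑ Y : Level A n, if h : X.1 ≤ Y.1 then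
      coef s X.1 Y.1 • F.map (homOfLE h).op (v Y) else 0 := rfl

theorem cubeDiff_cubeDiff (F : (ModifiedLattice A)ᵒᵖ ⥤ AddCommGrpCat.{0}) (n : ℕ)
    (v : ∀ Y : Level A n, F.obj (op Y.1)) : cubeDiff s F (n + 1) (cubeDiff s F n v) = 0 := by
  classical
  ext X
  rw [cubeDiff_apply, Pi.zero_apply]
  -- The condition can be weakened from `X ≤ Y ≤ Z` to `X ≤ Z`, because a coefficient vanishes when
  -- one of the two relations fails. The restriction map then no longer depends on `Y`, and the
  -- coefficients can be summed.
  have h1 : ∀ Y : Level A (n + 1), (if h : X.1 ≤ Y.1 then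
      coef s X.1 Y.1 • F.map (homOfLE h).op (cubeDiff s F n v Y) else 0) =
      ∑ Z : Level A n, if h : X.1 ≤ Z.1 then
        (coef s X.1 Y.1 * coef s Y.1 Z.1) • F.map (homOfLE h).op (v Z) else 0 := by
    intro Y
    by_cases h : X.1 ≤ Y.1
    · rw [dif_pos h, cubeDiff_apply]
      refine (congrArg (coef s X.1 Y.1 • ·) (map_sum (F.map (homOfLE h).op).hom _ _)).trans ?_
      refine Finset.smul_sum.trans (Finset.sum_congr rfl fun Z _ => ?_)
      by_cases h' : Y.1 ≤ Z.1
      · rw [dif_pos h', dif_pos (h.trans h'), mul_smul]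
        refine congrArg _ ((map_zsmul (F.map (homOfLE h).op).hom _ _).trans ?_)
        exact congrArg _ (map_map_le (F := F) _ _ _ _)
      · rw [dif_neg h', map_zero, smul_zero, coef_eq_zero s h', mul_zero]
        simp
    · rw [dif_neg h, coef_eq_zero s h]
      simp
  rw [Finset.sum_congr rfl fun Y _ => h1 Y, Finset.sum_comm]
  refine Finset.sum_eq_zero fun Z _ => ?_
  split_ifs with h
  · rw [← Finset.sum_smul, sum_coef_mul_coef, zero_smul]
  · exact Finset.sum_const_zero

/-- The cochains of the cube with two maximal elements. -/
noncomputable def cubeCochains : FreeCochains (ModifiedLattice A) where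
  ι n := Level A n
  pos _ X := X.1
  diff F n := cubeDiff s F n
  diff_naturality {F G} φ n v := by
    classical
    funext X
    rw [cubeDiff_apply, cubeDiff_apply]
    refine Eq.trans (Finset.sum_congr rfl fun Y _ => ?_)
      (map_sum (φ.app (op X.1)).hom _ _).symm
    split_ifs with h
    · refine Eq.trans ?_ (map_zsmul (φ.app (op X.1)).hom _ _).symm
      exact congrArg _ (NatTrans.naturality_apply φ _ _).symm
    · exact (map_zero (φ.app (op X.1)).hom).symm
  diff_diff F n v := cubeDiff_cubeDiff s F n v

/-- Above a singleton lie the two maximal elements, with opposite coefficients. -/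
theorem diff_one : (cubeCochains s).diff (constInt (ModifiedLattice A)) 0
    (fun _ => (1 : ℤ)) = 0 := by
  classical
  funext ⟨X, hX⟩
  refine (cubeDiff_apply s (constInt (ModifiedLattice A)) 0 (fun _ => (1 : ℤ)) ⟨X, hX⟩).trans ?_
  have h := sum_coef_smul s 0 hX (fun _ => (1 : ℤ))
  rw [← eq_of_of_card hX] at h
  refine Eq.trans (Finset.sum_congr rfl fun Y _ => ?_) (h.trans ?_)
  · split_ifs with h
    · rfl
    · exact (mul_eq_zero_of_left (coef_eq_zero s h) 1).symm
  · simp; rfl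

/-! ### Contractions of the cube resolution -/

open Classical in
/-- The basis element of `X` over `U` in degree `n`, or zero where there is none. -/
noncomputable def cubeBasis (U : ModifiedLattice A) (n : ℕ) (X : ModifiedLattice A) :
    (freePresheaf ((cubeCochains s).pos n)).obj (op U) :=
  if h : X.carrier.card = n ∧ U ≤ X then
    basis (p := (cubeCochains s).pos n) U (⟨X, h.1⟩ : Level A n) h.2 else 0

theorem cubeBasis_eq {U X : ModifiedLattice A} {n : ℕ} (h : X.carrier.card = n) (hU : U ≤ X) :
    cubeBasis s U n X = basis (p := (cubeCochains s).pos n) U (⟨X, h⟩ : Level A n) hU :=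
  dif_pos ⟨h, hU⟩

/-- A Koszul boundary in which, at the bottom, the empty set is replaced by its difference with
`one'`. All basis elements that occur lie over `U`, since each of them is above `of x`; the default
value zero plays no role. -/
theorem chainDiff_cubeBasis {U : ModifiedLattice A} {n : ℕ} {x : Finset A} (hx : x.card = n + 1)
    (hU : U ≤ of x) :
    ((cubeCochains s).chainDiff n).app (op U) (cubeBasis s U (n + 1) (of x)) =
      ∑ b ∈ x, (s.sign x (x.erase b) : ℤ) • (cubeBasis s U n (of (x.erase b)) -
        if n = 0 then cubeBasis s U n one' else 0) := by
  classical
  rw [← sum_coef_smul s n hx, cubeBasis_eq s (X := of x) (n := n + 1) hx hU]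
  refine (homEquiv_symm_app_basis (p := (cubeCochains s).pos (n + 1)) _ U
    (⟨of x, hx⟩ : Level A (n + 1)) hU).trans ?_
  refine (congrArg (fun z => (freePresheaf ((cubeCochains s).pos n)).map (homOfLE hU).op z)
    (cubeDiff_apply s _ n _ ⟨of x, hx⟩)).trans ?_
  refine (map_sum ((freePresheaf ((cubeCochains s).pos n)).map (homOfLE hU).op).hom _ _).trans ?_
  refine Finset.sum_congr rfl fun Y _ => ?_
  split_ifs with h
  · refine (map_zsmul ((freePresheaf ((cubeCochains s).pos n)).map
      (homOfLE hU).op).hom _ _).trans ?_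
    refine congrArg _ ?_
    refine (congrArg (fun z => (freePresheaf ((cubeCochains s).pos n)).map (homOfLE hU).op z)
      (map_basis (p := (cubeCochains s).pos n) (homOfLE h).op _ le_rfl)).trans ?_
    refine (map_basis (p := (cubeCochains s).pos n) (homOfLE hU).op _ _).trans ?_
    exact (cubeBasis_eq s Y.2 (hU.trans h)).symm
  · rw [coef_eq_zero s h, zero_smul]
    exact map_zero _

/-- Over a maximal element, the augmented complex is concentrated in degrees `0` and `-1`. -/
noncomputable def contractionOfMax (U : ModifiedLattice A) (hcard : U.carrier.card = 0)
    (hU : ∀ X, U ≤ X → X = U) : (cubeCochains s).Contraction U where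
  start := basis (p := (cubeCochains s).pos 0) U (⟨U, hcard⟩ : Level A 0) le_rfl
  homotopy _ := 0
  augmentation_start := augmentation_basis _ _ _ _
  zero := by
    rintro ⟨X, hX⟩ hi
    obtain rfl := hU X hi
    refine (congrArg (· + _) (map_zero ((cubeCochains s).chainDiff 0 |>.app (op _)).hom)).trans ?_
    exact zero_add _
  succ := by
    rintro n ⟨X, hX⟩ hi
    obtain rfl := hU X hi
    -- The only element above `U` is `U`, of rank `0`, so there is nothing to check in positive
    -- degrees.
    exact absurd (hcard.symm.trans hX) (by omega)

/-- The homotopy that adds `a` to a subset. -/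
noncomputable def addPoint (U : ModifiedLattice A) (a : A) (n : ℕ) :
    (freePresheaf ((cubeCochains s).pos n)).obj (op U) →+
      (freePresheaf ((cubeCochains s).pos (n + 1))).obj (op U) :=
  desc (p := (cubeCochains s).pos n) fun (X : Level A n) _ =>
    match X.1 with
    | of z => if a ∈ z then 0 else
        (s.sign (insert a z) z : ℤ) • cubeBasis s U (n + 1) (of (insert a z))
    -- The element `one'` will be the starting point of the contraction, so the homotopy has to
    -- vanish there.
    | one' => 0

theorem addPoint_of {U : ModifiedLattice A} (a : A) {n : ℕ} {z : Finset A} (hz : z.card = n)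
    (hU : U ≤ of z) : addPoint s U a n (cubeBasis s U n (of z)) = if a ∈ z then 0 else
      (s.sign (insert a z) z : ℤ) • cubeBasis s U (n + 1) (of (insert a z)) := by
  rw [cubeBasis_eq s (X := of z) hz hU]
  exact desc_basis (p := (cubeCochains s).pos n) _ (⟨of z, hz⟩ : Level A n) hU

theorem addPoint_one' (U : ModifiedLattice A) (a : A) (n : ℕ) :
    addPoint s U a n (cubeBasis s U n one') = 0 := by
  by_cases h : (one' : ModifiedLattice A).carrier.card = n ∧ U ≤ one'
  · rw [cubeBasis_eq s h.1 h.2]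
    exact desc_basis (p := (cubeCochains s).pos n) _ (⟨one', h.1⟩ : Level A n) h.2
  · rw [cubeBasis, dif_neg h, map_zero]

/-- The homotopy sends the empty set to a signed `{a}`, whose boundary carries the same sign; the
signs cancel and leave the empty set minus `one'`. -/
theorem chainDiff_addPoint_zero {u : Finset A} {a : A} (ha : a ∈ u) :
    ((cubeCochains s).chainDiff 0).app (op (of u)) (addPoint s (of u) a 0
      (cubeBasis s (of u) 0 (of ∅))) + cubeBasis s (of u) 0 one' =
        cubeBasis s (of u) 0 (of ∅) := by
  rw [addPoint_of s a Finset.card_empty (Finset.empty_subset u), if_neg (Finset.notMem_empty a),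
    map_zsmul, chainDiff_cubeBasis s (by simp)
      (of_le_of.2 (Finset.insert_subset ha (Finset.empty_subset u))), insert_empty_eq,
    Finset.sum_singleton, Finset.erase_singleton, if_pos rfl, ← mul_smul, sign_mul_self, one_smul,
    sub_add_cancel]

/-- The Koszul homotopy. If `a` is in `z`, the homotopy kills `z`, and in its boundary only the term
without `a` survives and gives back `z`. If not, deleting `a` from `insert a z` gives `z`, and for
each `b` in `z` the two remaining terms cancel by `sign_square`. -/
theorem chainDiff_addPoint_succ {u : Finset A} {a : A} (ha : a ∈ u) {n : ℕ} {z : Finset A}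
    (hz : z.card = n + 1) (hu : z ⊆ u) :
    ((cubeCochains s).chainDiff (n + 1)).app (op (of u)) (addPoint s (of u) a (n + 1)
      (cubeBasis s (of u) (n + 1) (of z))) + addPoint s (of u) a n
        (((cubeCochains s).chainDiff n).app (op (of u)) (cubeBasis s (of u) (n + 1) (of z))) =
          cubeBasis s (of u) (n + 1) (of z) := by
  have h2 : addPoint s (of u) a n
      (((cubeCochains s).chainDiff n).app (op (of u)) (cubeBasis s (of u) (n + 1) (of z))) =
      ∑ b ∈ z, if a ∈ z.erase b then 0 else
        ((s.sign z (z.erase b) : ℤ) * s.sign (insert a (z.erase b)) (z.erase b)) •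
          cubeBasis s (of u) (n + 1) (of (insert a (z.erase b))) := by
    rw [chainDiff_cubeBasis s hz hu, map_sum]
    refine Finset.sum_congr rfl fun b hb => ?_
    -- For `n = 0` the boundary also involves `one'`, which the homotopy kills, so the same formula
    -- holds in all degrees.
    have h0 : addPoint s (of u) a n (if n = 0 then cubeBasis s (of u) n one' else 0) = 0 := by
      split_ifs
      · exact addPoint_one' s _ a n
      · exact map_zero _
    rw [map_zsmul, map_sub, h0, sub_zero,
      addPoint_of s a (by rw [Finset.card_erase_of_mem hb, hz]; rfl)
      (of_le_of.2 ((Finset.erase_subset b z).trans hu))]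
    split_ifs
    · exact smul_zero _
    · rw [mul_smul]
  rw [h2, addPoint_of s a hz hu]
  by_cases haz : a ∈ z
  · rw [if_pos haz, map_zero, zero_add, Finset.sum_eq_single_of_mem a haz]
    · rw [if_neg (Finset.notMem_erase a z), Finset.insert_erase haz, sign_mul_self, one_smul]
    · exact fun b _ hb => if_pos (Finset.mem_erase.2 ⟨hb.symm, haz⟩)
  · rw [if_neg haz, map_zsmul, chainDiff_cubeBasis s (by rw [Finset.card_insert_of_notMem haz, hz])
      (of_le_of.2 (Finset.insert_subset ha hu)), if_neg n.succ_ne_zero, Finset.sum_insert haz,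
      smul_add, sub_zero, Finset.erase_insert haz, ← mul_smul, sign_mul_self, one_smul, add_assoc,
      Finset.smul_sum, ← Finset.sum_add_distrib, Finset.sum_eq_zero, add_zero]
    intro b hb
    have hab : a ≠ b := by rintro rfl; exact haz hb
    rw [if_neg (fun h => haz (Finset.mem_of_mem_erase h)), sub_zero, ← mul_smul,
      Finset.erase_insert_of_ne hab, ← add_smul, sign_square s haz hb, zero_smul]

/-- Over a nonempty subset, adding a point of the subset contracts the augmented complex. -/
noncomputable def contractionOfMem {u : Finset A} {a : A} (ha : a ∈ u) :
    (cubeCochains s).Contraction (of u) where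
  -- A nonempty `u` lies below `one'`. With this start, the identity in degree 0 says that the
  -- homotopy joins the empty set to `one'` and is constant on `one'`.
  start := cubeBasis s (of u) 0 one'
  homotopy := addPoint s (of u) a
  augmentation_start := by
    rw [cubeBasis_eq s (X := one') (n := 0) Finset.card_empty
      (of_le_one'.2 (Finset.ne_empty_of_mem ha))]
    exact augmentation_basis _ _ _ _
  zero := by
    rintro ⟨X, hX⟩ hi
    cases X with
    | of z =>
      obtain rfl := Finset.card_eq_zero.1 hX
      have h := chainDiff_addPoint_zero s ha
      rwa [cubeBasis_eq s (X := of ∅) hX hi] at h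
    | one' =>
      have h := addPoint_one' s (of u) a 0
      rw [cubeBasis_eq s (X := one') hX hi] at h ⊢
      exact (congrArg (fun z => ((cubeCochains s).chainDiff 0).app (op (of u)) z + _) h).trans
        ((congrArg (· + _) (map_zero _)).trans (zero_add _))
  succ := by
    rintro n ⟨X, hX⟩ hi
    cases X with
    | of z =>
      have h := chainDiff_addPoint_succ s (z := z) ha hX hi
      rwa [cubeBasis_eq s (X := of z) hX hi] at h
    | one' => cases hX

/-- The two maximal elements have nothing else above them; any other element is a nonempty subset
and contains a point to add. -/
theorem nonempty_contraction (U : ModifiedLattice A) :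
    Nonempty ((cubeCochains s).Contraction U) := by
  cases U with
  | of u =>
    obtain rfl | ⟨a, ha⟩ := u.eq_empty_or_nonempty
    · exact ⟨contractionOfMax s _ rfl fun X => of_empty_le_iff.1⟩
    · exact ⟨contractionOfMem s ha⟩
  | one' => exact ⟨contractionOfMax s _ rfl fun X => one'_le_iff.1⟩

/-! ### Coefficients extended by zero, and the comparison -/

/-- A family of values of a presheaf on the Boolean lattice, extended by zero. -/
def extendCochain (F : (BooleanLattice A)ᵒᵖ ⥤ AddCommGrpCat.{0}) {n : ℕ}
    (v : ∀ x : BooleanLattice.Row A n, F.obj (op (OrderDual.toDual x.1))) :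
    ∀ Y : Level A n, (extend F).obj (op Y.1)
  | ⟨of x, h⟩ => v ⟨x, h⟩
  | ⟨one', _⟩ => PUnit.unit

/-- Cochains of the cube are the same as cochains of the cube with two maximal elements with
coefficients extended by zero. -/
def extendCochainEquiv (F : (BooleanLattice A)ᵒᵖ ⥤ AddCommGrpCat.{0}) (n : ℕ) :
    (∀ x : BooleanLattice.Row A n, F.obj (op (OrderDual.toDual x.1))) ≃+
      ∀ Y : Level A n, (extend F).obj (op Y.1) where
  toFun := extendCochain F
  invFun w x := w ⟨of x.1, x.2⟩
  left_inv _ := rfl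
  right_inv w := by
    funext ⟨Y, hY⟩
    cases Y <;> rfl
  map_add' v w := by
    funext ⟨Y, hY⟩
    cases Y <;> rfl

/-- The two differentials differ only by the summand at `one'`, which is the image of the element of
a zero group. On subsets the coefficients are the signs and the restriction maps are those of `F`.
-/
theorem cubeDiff_extendCochain (F : (BooleanLattice A)ᵒᵖ ⥤ AddCommGrpCat.{0}) (n : ℕ)
    (v : ∀ x : BooleanLattice.Row A n, F.obj (op (OrderDual.toDual x.1))) :
    cubeDiff s (extend F) n (extendCochain F v) =
      extendCochain F (BooleanLattice.diffHom F s n v) := by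
  classical
  funext ⟨X, hX⟩
  cases X with
  | one' => rfl
  | of x =>
    -- The subsets of size `n` inject into the level, and the only index that can be missed is
    -- `one'`.
    refine (cubeDiff_apply s _ n _ _).trans (Fintype.sum_of_injective
      (fun y : BooleanLattice.Row A n => (⟨of y.1, y.2⟩ : Level A n)) ?_ _ _ ?_ ?_).symm
    · intro y z h
      exact Subtype.ext (congrArg (fun Y : Level A n => Y.1.carrier) h)
    · rintro ⟨Y, hY⟩ h
      cases Y with
      | of y => exact (h ⟨⟨y, hY⟩, rfl⟩).elim
      | one' =>
        split_ifs with h'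
        · exact (congrArg _ (map_zero _)).trans (smul_zero _)
        · rfl
    · rintro ⟨y, hy⟩
      by_cases h : y ⊆ x
      · rw [dif_pos h, dif_pos (of_le_of.2 h), coef_of s h]
        rfl
      · rw [dif_neg h, dif_neg (mt of_le_of.1 h)]
        rfl

/-- On a presheaf that is extended by zero, the cube with two maximal elements gives the cochain
complex of the cube. -/
noncomputable def cochainComplexExtendIso (F : (BooleanLattice A)ᵒᵖ ⥤ AddCommGrpCat.{0}) :
    BooleanLattice.cubeComplex F s ≅ (cubeCochains s).cochainComplex (extend F) :=
  HomologicalComplex.Hom.isoOfComponents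
    (fun n => (extendCochainEquiv F n).toAddCommGrpIso) (by
      intro i j hij
      obtain rfl : i + 1 = j := hij
      apply AddCommGrpCat.hom_ext
      apply AddMonoidHom.ext
      intro v
      refine (congrArg (fun k => k.hom (extendCochain F v))
        ((cubeCochains s).cochainComplex_d (extend F) i)).trans ?_
      refine (cubeDiff_extendCochain s F i v).trans ?_
      exact congrArg (fun k => extendCochain F (AddCommGrpCat.Hom.hom k v))
        (CochainComplex.of_d (BooleanLattice.cochains F)
          (fun n => AddCommGrpCat.ofHom (BooleanLattice.diffHom F s n)) i).symm)

end ModifiedLattice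

theorem proposition1p4 (D : LinkDiagram) (s : Signage D.Crossing) (i : ℕ) :
    Nonempty (D.unnormalisedKhovanovHomology s i ≅
      NerveCohomology.nerveCohomology D.khovanovPresheaf i) := by
  obtain ⟨e⟩ := FreeCochains.nonempty_homology_iso (ModifiedLattice.cubeCochains s)
    (NerveCohomology.nerveCochains _) (ModifiedLattice.diff_one s) NerveCohomology.diff_one
    (fun U => (ModifiedLattice.nonempty_contraction s U).some) NerveCohomology.contraction
    D.khovanovPresheaf i
  -- The nerve complex is by definition the cochain complex of `nerveCochains`; only the cube side
  -- needs an isomorphism, which discards the zero group at `one'`.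
  exact ⟨HomologicalComplex.homologyMapIso
    (ModifiedLattice.cochainComplexExtendIso s D.khovanovCube) i ≪≫ e⟩
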